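/- Let $X$ be a finite set and let $(X,\{R_0,R_1,R_2,R_3\})$ be a symmetric association scheme of class $3$: $R_0,\dots,R_3$ are nonempty symmetric relations that partition $X\times X$, $R_0$ is the identity relation, and for all $i,j,h$ the number of $z$ with $(x,z)\in R_i$, $(z,y)\in R_j$ is the same for all $(x,y)\in R_h$. Let $A_0,\dots,A_3$ be the adjacency matrices, let $E_0=\frac1{|X|}J,E_1,E_2,E_3$ be an ordering of the primitive idempotents of the algebra $\mathrm{span}(A_0,\dots,A_3)$, and define the Krein parameters $q_{i,j}^h$ by $E_i\circ E_j=\frac1{|X|}\sum_h q_{i,j}^hE_h$, where $\circ$ is the entrywise product. Assume that the scheme is $Q$-polynomial with respect to this ordering, i.e. $q_{i,j}^h=0$ (resp. $q_{i,j}^h\neq0$) whenever one of $h,i,j$ is greater than (resp. equal to) the sum of the other two. Put $a_i^*=q_{1,i}^i$ and $b_1^*=q_{1,2}^1$, and let the dual eigenvalues $\theta_h^*$ be defined by $E_1=\frac1{|X|}\sum_h\theta_h^*A_h$, where $R_1,R_2,R_3$ are labelled so that $m=\theta_0^*>\theta_1^*>\theta_2^*>\theta_3^*$. The scheme is called $Q$-bipartite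 if $a_i^*=0$ for all $i$, and dual-tight if it is not $Q$-bipartite and $$\Big(\theta_1^*+\frac{m}{a_1^*+1}\Big)\Big(\theta_3^*+\frac{m}{a_1^*+1}\Big)=-\frac{m\,a_1^*\,b_1^*}{(a_1^*+1)^2}.$$ Then the scheme is dual-tight if and only if for some $i\neq0$ the graph $(X,R_i)$ is (isomorphic to) the incidence graph of a nontrivial symmetric design, that is, of an incidence structure with $v$ points and $v$ blocks such that every block has exactly $k$ points, where $1<k<v-1$, and any two distinct points lie on exactly $\lambda$ common blocks, for some integers $v,k,\lambda$. -/

import Mathlib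

universe u

open scoped Matrix

/-- A (symmetric) association scheme of class `d` on a finite set `X`.  The partition
`R_0, …, R_d` of `X × X` into nonempty relations is encoded by the function `rel` sending
`(x, y)` to the index `i` with `(x, y) ∈ R_i`. -/
structure AssociationScheme (X : Type u) [Fintype X] (d : ℕ) where
  rel : X → X → Fin (d + 1)
  rel_nonempty : ∀ i, ∃ x y, rel x y = i
  rel_eq_zero_iff : ∀ x y, rel x y = 0 ↔ x = y
  rel_symm : ∀ x y, rel x y = rel y x
  /-- The intersection numbers `p_{i,j}^h` are well defined. -/
  regular : ∀ i j h : Fin (d + 1), ∃ p : ℕ, ∀ x y, rel x y = h →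
    (Finset.univ.filter fun z => rel x z = i ∧ rel z y = j).card = p

namespace AssociationScheme

variable {X : Type u} [Fintype X] {d : ℕ}

/-- The adjacency matrix `A_i` of the relation `R_i`. -/
def adj (S : AssociationScheme X d) (i : Fin (d + 1)) : Matrix X X ℝ :=
  Matrix.of fun x y => if S.rel x y = i then 1 else 0

/-- The graph `(X, R_i)`, for `i ≠ 0`. -/
def graph (S : AssociationScheme X d) (i : Fin (d + 1)) (hi : i ≠ 0) : SimpleGraph X where
  Adj x y := S.rel x y = i
  symm := ⟨fun x y h => (S.rel_symm y x).trans h⟩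
  loopless := ⟨fun x h => hi (h.symm.trans ((S.rel_eq_zero_iff x x).2 rfl))⟩

end AssociationScheme

/-- An ordering `E_0 = J/|X|, E_1, …, E_d` of the primitive idempotents of the Bose–Mesner algebra
`span (A_0, …, A_d)`, together with the dual eigenvalues `Q h j`, that is, the coefficients in
`E_j = |X|⁻¹ ∑_h Q h j A_h` (they are determined by the `E_j`).  As the algebra has dimension
`d + 1`, the primitive idempotents are precisely `d + 1` nonzero, mutually orthogonal idempotents
of it. -/
structure PrimitiveIdempotents {X : Type u} [Fintype X] [DecidableEq X] {d : ℕ}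
    (S : AssociationScheme X d) where
  E : Fin (d + 1) → Matrix X X ℝ
  Q : Fin (d + 1) → Fin (d + 1) → ℝ
  E_eq : ∀ j, E j = (Fintype.card X : ℝ)⁻¹ • ∑ h, Q h j • S.adj h
  E_zero : E 0 = (Fintype.card X : ℝ)⁻¹ • Matrix.of fun _ _ => (1 : ℝ)
  E_ne_zero : ∀ j, E j ≠ 0
  E_idem : ∀ j, E j * E j = E j
  E_orth : ∀ i j, i ≠ j → E i * E j = 0
  E_sum : ∑ j, E j = 1

namespace PrimitiveIdempotents

variable {X : Type u} [Fintype X] [DecidableEq X] {d : ℕ} {S : AssociationScheme X d}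

/-- The Krein parameter `q_{i,j}^h`, that is, the coefficient in
`E_i ∘ E_j = |X|⁻¹ ∑_h q_{i,j}^h E_h` (see `hadamard_eq`), extracted by means of the trace. -/
noncomputable def krein (P : PrimitiveIdempotents S) (i j h : Fin (d + 1)) : ℝ :=
  (Fintype.card X : ℝ) * ((P.E i ⊙ P.E j) * P.E h).trace / (P.E h).trace

theorem trace_ne_zero (P : PrimitiveIdempotents S) (h : Fin (d + 1)) : (P.E h).trace ≠ 0 := by
  have hs : (P.E h)ᵀ = P.E h := by
    rw [P.E_eq]
    ext x y
    simp [Matrix.sum_apply, AssociationScheme.adj, S.rel_symm y x]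
  intro h0
  apply P.E_ne_zero h
  rw [← Matrix.trace_conjTranspose_mul_self_eq_zero_iff (A := P.E h),
    Matrix.conjTranspose_eq_transpose_of_trivial, hs, P.E_idem, h0]

theorem mem_span (P : PrimitiveIdempotents S) {M : Matrix X X ℝ}
    (hM : M ∈ Submodule.span ℝ (Set.range S.adj)) : M ∈ Submodule.span ℝ (Set.range P.E) := by
  have hli : LinearIndependent ℝ P.E := by
    rw [Fintype.linearIndependent_iff]
    intro g hg i
    have h1 : (∑ j, g j • P.E j) * P.E i = g i • P.E i := by
      rw [Finset.sum_mul, Finset.sum_eq_single i]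
      · rw [smul_mul_assoc, P.E_idem]
      · intro j _ hj
        rw [smul_mul_assoc, P.E_orth j i hj, smul_zero]
      · simp
    rw [hg, zero_mul] at h1
    exact (smul_eq_zero.1 h1.symm).resolve_right (P.E_ne_zero i)
  have hle : Submodule.span ℝ (Set.range P.E) ≤ Submodule.span ℝ (Set.range S.adj) := by
    rw [Submodule.span_le]
    rintro _ ⟨j, rfl⟩
    rw [P.E_eq]
    exact Submodule.smul_mem _ _ (Submodule.sum_mem _ fun h _ =>
      Submodule.smul_mem _ _ (Submodule.subset_span ⟨h, rfl⟩))
  have hfin : Module.finrank ℝ (Submodule.span ℝ (Set.range S.adj)) ≤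
      Module.finrank ℝ (Submodule.span ℝ (Set.range P.E)) := by
    rw [finrank_span_eq_card hli]
    exact finrank_range_le_card S.adj
  rw [Submodule.eq_of_le_of_finrank_le hle hfin]
  exact hM

theorem hadamard_eq (P : PrimitiveIdempotents S) (i j : Fin (d + 1)) :
    P.E i ⊙ P.E j = (Fintype.card X : ℝ)⁻¹ • ∑ h, P.krein i j h • P.E h := by
  have hcard : (Fintype.card X : ℝ) ≠ 0 := by
    obtain ⟨x, -⟩ := S.rel_nonempty 0
    have : Nonempty X := ⟨x⟩
    exact Nat.cast_ne_zero.2 Fintype.card_ne_zero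
  have hmem : P.E i ⊙ P.E j ∈ Submodule.span ℝ (Set.range S.adj) := by
    have : P.E i ⊙ P.E j = ∑ h, (((Fintype.card X : ℝ)⁻¹ * P.Q h i) *
        ((Fintype.card X : ℝ)⁻¹ * P.Q h j)) • S.adj h := by
      ext x y
      rw [Matrix.hadamard_apply, P.E_eq, P.E_eq]
      simp [Matrix.sum_apply, AssociationScheme.adj]
    rw [this]
    exact Submodule.sum_mem _ fun h _ =>
      Submodule.smul_mem _ _ (Submodule.subset_span ⟨h, rfl⟩)
  obtain ⟨c, hc⟩ := (Submodule.mem_span_range_iff_exists_fun ℝ).1 (P.mem_span hmem)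
  have hq : ∀ h, P.krein i j h = (Fintype.card X : ℝ) * c h := by
    intro h
    have h1 : (P.E i ⊙ P.E j) * P.E h = c h • P.E h := by
      rw [← hc, Finset.sum_mul, Finset.sum_eq_single h]
      · rw [smul_mul_assoc, P.E_idem]
      · intro l _ hl
        rw [smul_mul_assoc, P.E_orth l h hl, smul_zero]
      · simp
    rw [krein, h1, Matrix.trace_smul, smul_eq_mul]
    field_simp [P.trace_ne_zero h]
  rw [← hc, Finset.smul_sum]
  refine Finset.sum_congr rfl fun h _ => ?_
  rw [hq, smul_smul, inv_mul_cancel_left₀ hcard]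

/-- The scheme is `Q`-polynomial with respect to the ordering `E_0, …, E_d`: `q_{i,j}^h` vanishes
if one of `h, i, j` is greater than the sum of the other two, and does not vanish if one of them
equals the sum of the other two. -/
def IsQPolynomial (P : PrimitiveIdempotents S) : Prop :=
  ∀ i j h : Fin (d + 1),
    (((h : ℕ) > i + j ∨ (i : ℕ) > h + j ∨ (j : ℕ) > h + i) → P.krein i j h = 0) ∧
    (((h : ℕ) = i + j ∨ (i : ℕ) = h + j ∨ (j : ℕ) = h + i) → P.krein i j h ≠ 0)

end PrimitiveIdempotents

/-- A `Q`-polynomial structure on an association scheme: an ordering of the primitive idempotents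
with respect to which the scheme is `Q`-polynomial. -/
structure QPolynomialStructure {X : Type u} [Fintype X] [DecidableEq X] {d : ℕ}
    (S : AssociationScheme X d) extends PrimitiveIdempotents S where
  isQPolynomial : toPrimitiveIdempotents.IsQPolynomial

namespace QPolynomialStructure

variable {X : Type u} [Fintype X] [DecidableEq X] {d : ℕ} {S : AssociationScheme X d}

/-- The dual eigenvalue `θ_h^*` attached to the relation `R_h`:
`E_1 = |X|⁻¹ ∑_h θ_h^* A_h`. -/
def dualEigenvalue (P : QPolynomialStructure S) (h : Fin (d + 1)) : ℝ := P.Q h 1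

/-- `m = θ_0^*`, the rank of `E_1`. -/
def m (P : QPolynomialStructure S) : ℝ := P.dualEigenvalue 0

/-- The second largest dual eigenvalue.  The relations are labelled arbitrarily except for `R_0`,
and `θ_0^* = m` is the largest dual eigenvalue. -/
noncomputable def thetaSecond (P : QPolynomialStructure S) : ℝ :=
  ⨆ h : {h : Fin (d + 1) // h ≠ 0}, P.dualEigenvalue h

/-- The smallest dual eigenvalue. -/
noncomputable def thetaLast (P : QPolynomialStructure S) : ℝ :=
  ⨅ h : Fin (d + 1), P.dualEigenvalue h

/-- `a_i^* = q_{1,i}^i`. -/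
noncomputable def aStar (P : QPolynomialStructure S) (i : Fin (d + 1)) : ℝ := P.krein 1 i i

/-- `b_i^* = q_{1,i+1}^i` (for `i < d`). -/
noncomputable def bStar (P : QPolynomialStructure S) (i : Fin d) : ℝ :=
  P.krein 1 i.succ i.castSucc

/-- `Q`-bipartite: all `a_i^*` vanish. -/
def IsQBipartite (P : QPolynomialStructure S) : Prop := ∀ i, P.aStar i = 0

end QPolynomialStructure

/-- Dual-tight: not `Q`-bipartite, with equality in the dual fundamental bound.  The class is
`d + 2 ≥ 2`, so that `b_1^*` makes sense. -/
def QPolynomialStructure.IsDualTight {X : Type u} [Fintype X] [DecidableEq X] {d : ℕ}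
    {S : AssociationScheme X (d + 2)} (P : QPolynomialStructure S) : Prop :=
  ¬ P.IsQBipartite ∧
    (P.thetaSecond + P.m / (P.aStar 1 + 1)) * (P.thetaLast + P.m / (P.aStar 1 + 1)) =
      -(P.m * P.aStar 1 * P.bStar 1 / (P.aStar 1 + 1) ^ 2)

/-- A (nontrivial) symmetric `2-(v, k, l)` design with points `P` and blocks `B`: `v` points,
`v` blocks, `k` points on every block with `1 < k < v - 1`, and `l` blocks through any two distinct
points. -/
structure SymmetricDesign (P B : Type u) [Fintype P] [Fintype B] where
  inc : P → B → Prop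
  v : ℕ
  k : ℕ
  l : ℕ
  card_points : Fintype.card P = v
  card_blocks : Fintype.card B = v
  block_size : ∀ b, {p | inc p b}.ncard = k
  balanced : ∀ p q, p ≠ q → {b | inc p b ∧ inc q b}.ncard = l
  one_lt_k : 1 < k
  k_lt : k + 1 < v

/-- The incidence graph: the bipartite graph on points and blocks, a point being adjacent to the
blocks it is incident with. -/
def SymmetricDesign.incidenceGraph {P B : Type u} [Fintype P] [Fintype B]
    (D : SymmetricDesign P B) : SimpleGraph (P ⊕ B) where
  Adj
    | .inl p, .inr b => D.inc p b
    | .inr b, .inl p => D.inc p b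
    | _, _ => False
  symm := ⟨by rintro (p | b) (q | c) h <;> exact h⟩
  loopless := ⟨by rintro (p | b) h <;> exact h⟩

/-- A graph is (isomorphic to) the incidence graph of a symmetric design. -/
def IsSymmetricDesignIncidenceGraph {X : Type u} (G : SimpleGraph X) : Prop :=
  ∃ (P B : Type u) (_ : Fintype P) (_ : Fintype B) (D : SymmetricDesign P B),
    Nonempty (G ≃g D.incidenceGraph)

/-! Write `m`, `θ₁ > θ₂ > θ₃` for the dual eigenvalues, `a = q_{1,1}^1`, `b = q_{1,2}^1`. For fixed
`x`, let `y` run over the `R_i`-neighbours and `z` over the `R_j`-neighbours of `x`. The dual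
eigenvalue of the pair `(y, z)` has mean `θ_i θ_j / m`, and `sum_sum_sq_sub` computes its variance.
For the indices of `θ₁` and `θ₃`, the tightness equation says exactly that this variance vanishes.

If the scheme is dual-tight, the pairs thus all have dual eigenvalue `θ₁θ₃/m`, and signs and sizes
force this to be `θ₂`. Vieta's formulas for the dual eigenvalues other than `m`
(`tridiagonal_of_tight`) express the remaining Krein parameters through `θ₂`; nonnegativity of
`q_{2,3}^3` and `q_{3,3}^3` then gives `θ₂ = -1` (`mid_eq_neg_one`). The third idempotent now has
entries `±1/|X|`, so it is the signature of a bipartition with `R_0`, `R_j` inside the parts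
(`Q_three_of_tight`), and `R_i` is the incidence relation of a symmetric design.

Conversely, the incidence graph of a symmetric design forces the other relations to be "same part"
and "non-incident" (`exists_bipartition_of_design`). Counting then gives `θ_j = -1`, `θ_i θ_l = -m`
and `2a = m - 1 + θ_i + θ_l` (`Q_one_of_bipartition`), which imply tightness. Nontriviality of the
design excludes the `Q`-bipartite case. -/

/-! ### Valencies and sums over the relations. -/

namespace AssociationScheme

variable {X : Type u} [Fintype X] {d : ℕ}

theorem card_pos (S : AssociationScheme X d) : (0 : ℝ) < Fintype.card X := by
  obtain ⟨x, -⟩ := S.rel_nonempty 0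
  have : Nonempty X := ⟨x⟩
  exact Nat.cast_pos.2 Fintype.card_pos

/-- The valency `k_h` of the relation `R_h`. -/
noncomputable def valency (S : AssociationScheme X d) (h : Fin (d + 1)) : ℕ :=
  (S.regular h h 0).choose

theorem card_rel (S : AssociationScheme X d) (h : Fin (d + 1)) (x : X) :
    (Finset.univ.filter fun z => S.rel x z = h).card = S.valency h := by
  rw [valency, ← (S.regular h h 0).choose_spec x x ((S.rel_eq_zero_iff x x).2 rfl)]
  congr 1
  ext z
  simp [S.rel_symm z x]

theorem valency_pos (S : AssociationScheme X d) (h : Fin (d + 1)) : 0 < S.valency h := by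
  obtain ⟨x, y, hxy⟩ := S.rel_nonempty h
  rw [← S.card_rel h x]
  exact Finset.card_pos.2 ⟨y, by simp [hxy]⟩

theorem exists_rel (S : AssociationScheme X d) (h : Fin (d + 1)) (x : X) :
    ∃ y, S.rel x y = h := by
  have h1 := S.valency_pos h
  rw [← S.card_rel h x] at h1
  obtain ⟨y, hy⟩ := Finset.card_pos.1 h1
  exact ⟨y, by simpa using hy⟩

theorem rel_self (S : AssociationScheme X d) (x : X) : S.rel x x = 0 :=
  (S.rel_eq_zero_iff x x).2 rfl

theorem valency_zero (S : AssociationScheme X d) : S.valency 0 = 1 := by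
  obtain ⟨x, -⟩ := S.rel_nonempty 0
  rw [← S.card_rel 0 x, Finset.card_eq_one]
  exact ⟨x, by ext z; simp [S.rel_eq_zero_iff, eq_comm]⟩

theorem sum_rel (S : AssociationScheme X d) (f : Fin (d + 1) → ℝ) (x : X) :
    ∑ z, f (S.rel x z) = ∑ h, S.valency h * f h := by
  rw [← Finset.sum_fiberwise Finset.univ (fun z => S.rel x z)]
  refine Finset.sum_congr rfl fun h _ => ?_
  rw [← S.card_rel h x, ← nsmul_eq_mul, ← Finset.sum_const]
  refine Finset.sum_congr rfl fun z hz => ?_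
  rw [(Finset.mem_filter.1 hz).2]

theorem sum_sum_rel (S : AssociationScheme X d) (f : Fin (d + 1) → ℝ) :
    ∑ x, ∑ z, f (S.rel x z) = Fintype.card X * ∑ h, S.valency h * f h := by
  simp [S.sum_rel]

end AssociationScheme

/-! ### Bose–Mesner identities for dual eigenvalues and Krein parameters. -/

namespace PrimitiveIdempotents

variable {X : Type u} [Fintype X] [DecidableEq X] {d : ℕ} {S : AssociationScheme X d}

theorem E_apply (P : PrimitiveIdempotents S) (j : Fin (d + 1)) (x y : X) :
    P.E j x y = (Fintype.card X : ℝ)⁻¹ * P.Q (S.rel x y) j := by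
  rw [P.E_eq]
  simp [Matrix.sum_apply, AssociationScheme.adj]

theorem Q_rel (P : PrimitiveIdempotents S) (j : Fin (d + 1)) (x y : X) :
    P.Q (S.rel x y) j = Fintype.card X * P.E j x y := by
  rw [P.E_apply, mul_inv_cancel_left₀ S.card_pos.ne']

theorem E_symm (P : PrimitiveIdempotents S) (j : Fin (d + 1)) (x y : X) :
    P.E j x y = P.E j y x := by
  rw [P.E_apply, P.E_apply, S.rel_symm]

theorem Q_zero_right (P : PrimitiveIdempotents S) (h : Fin (d + 1)) : P.Q h 0 = 1 := by
  obtain ⟨x, y, rfl⟩ := S.rel_nonempty h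
  rw [P.Q_rel, P.E_zero]
  simp [S.card_pos.ne']

theorem trace_E (P : PrimitiveIdempotents S) (j : Fin (d + 1)) : (P.E j).trace = P.Q 0 j := by
  simp [Matrix.trace, P.E_apply, S.rel_self, S.card_pos.ne']

theorem E_posSemidef (P : PrimitiveIdempotents S) (j : Fin (d + 1)) : (P.E j).PosSemidef := by
  have h1 : (P.E j)ᴴ = P.E j := by
    ext x y
    simp [P.E_symm j y x]
  have h2 := Matrix.posSemidef_conjTranspose_mul_self (P.E j)
  rwa [h1, P.E_idem] at h2

theorem Q_zero_left_pos (P : PrimitiveIdempotents S) (j : Fin (d + 1)) : 0 < P.Q 0 j := by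
  rw [← P.trace_E]
  exact lt_of_le_of_ne (P.E_posSemidef j).trace_nonneg (P.trace_ne_zero j).symm

/-- Entrywise form of the definition of the Krein parameters. -/
theorem Q_mul_Q (P : PrimitiveIdempotents S) (h i j : Fin (d + 1)) :
    P.Q h i * P.Q h j = ∑ l, P.krein i j l * P.Q h l := by
  obtain ⟨x, y, rfl⟩ := S.rel_nonempty h
  have h1 := congrFun (congrFun (P.hadamard_eq i j) x) y
  have hn := S.card_pos.ne'
  rw [Matrix.hadamard_apply, Matrix.smul_apply, Matrix.sum_apply] at h1
  simp only [Matrix.smul_apply, smul_eq_mul] at h1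
  simp only [P.Q_rel]
  rw [show (Fintype.card X : ℝ) * P.E i x y * (Fintype.card X * P.E j x y) =
    Fintype.card X * Fintype.card X * (P.E i x y * P.E j x y) by ring, h1, mul_assoc,
    mul_inv_cancel_left₀ hn, Finset.mul_sum]
  exact Finset.sum_congr rfl fun l _ => by ring

/-- The right side is symmetric in the three indices. This yields the symmetries of the Krein
parameters, and for equal indices the third moment of a dual eigenvalue. -/
theorem krein_eq (P : PrimitiveIdempotents S) (i j h : Fin (d + 1)) :
    P.krein i j h * (Fintype.card X * P.Q 0 h) =
      ∑ g, S.valency g * (P.Q g i * P.Q g j * P.Q g h) := by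
  have hn := S.card_pos.ne'
  have hm := (P.Q_zero_left_pos h).ne'
  have h1 : ((P.E i ⊙ P.E j) * P.E h).trace = ((Fintype.card X : ℝ)⁻¹) ^ 3 *
      ∑ x, ∑ y, P.Q (S.rel x y) i * P.Q (S.rel x y) j * P.Q (S.rel x y) h := by
    simp only [Matrix.trace, Matrix.diag, Matrix.mul_apply, Matrix.hadamard_apply, P.E_apply,
      Finset.mul_sum]
    refine Finset.sum_congr rfl fun x _ => Finset.sum_congr rfl fun y _ => ?_
    rw [S.rel_symm y x]
    ring
  rw [krein, h1, P.trace_E, S.sum_sum_rel fun g => P.Q g i * P.Q g j * P.Q g h]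
  field_simp

/-- Schur product theorem: the entrywise product of positive semidefinite matrices is positive
semidefinite, and compressing by `E h` keeps the trace nonnegative. -/
theorem krein_nonneg (P : PrimitiveIdempotents S) (i j h : Fin (d + 1)) : 0 ≤ P.krein i j h := by
  have h1 : ((P.E i ⊙ P.E j) * P.E h).trace = (P.E h * (P.E i ⊙ P.E j) * (P.E h)ᴴ).trace := by
    have h2 : (P.E h)ᴴ = P.E h := (P.E_posSemidef h).isHermitian
    rw [h2, Matrix.trace_mul_comm (P.E h * _), ← Matrix.mul_assoc, P.E_idem,
      Matrix.trace_mul_comm]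
  rw [krein, P.trace_E, h1]
  have h2 := (((P.E_posSemidef i).hadamard (P.E_posSemidef j)).mul_mul_conjTranspose_same
    (P.E h)).trace_nonneg
  exact div_nonneg (mul_nonneg S.card_pos.le h2) (P.Q_zero_left_pos h).le

theorem krein_comm (P : PrimitiveIdempotents S) (i j h : Fin (d + 1)) :
    P.krein i j h = P.krein j i h := by
  rw [krein, krein, Matrix.hadamard_comm]

theorem krein_mul_rotate (P : PrimitiveIdempotents S) (i j h : Fin (d + 1)) :
    P.krein i j h * P.Q 0 h = P.krein h j i * P.Q 0 i := by
  have h1 := P.krein_eq i j h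
  have h2 := P.krein_eq h j i
  have h3 : ∑ g, (S.valency g : ℝ) * (P.Q g i * P.Q g j * P.Q g h) =
      ∑ g, S.valency g * (P.Q g h * P.Q g j * P.Q g i) :=
    Finset.sum_congr rfl fun g _ => by ring
  rw [h3, ← h2] at h1
  apply mul_left_cancel₀ S.card_pos.ne'
  linear_combination h1

/-- Orthogonality relations for the dual eigenvalues. -/
theorem sum_valency_mul_Q_mul_Q (P : PrimitiveIdempotents S) (i j : Fin (d + 1)) :
    ∑ g, S.valency g * (P.Q g i * P.Q g j) =
      if i = j then Fintype.card X * P.Q 0 i else 0 := by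
  have hn := S.card_pos.ne'
  have h1 : (P.E i * P.E j).trace = (Fintype.card X : ℝ)⁻¹ ^ 2 *
      ∑ x, ∑ y, P.Q (S.rel x y) i * P.Q (S.rel x y) j := by
    simp only [Matrix.trace, Matrix.diag, Matrix.mul_apply, P.E_apply, Finset.mul_sum]
    refine Finset.sum_congr rfl fun x _ => Finset.sum_congr rfl fun y _ => ?_
    rw [S.rel_symm y x]
    ring
  rw [S.sum_sum_rel fun g => P.Q g i * P.Q g j] at h1
  have h2 : (P.E i * P.E j).trace = if i = j then P.Q 0 i else 0 := by
    split_ifs with hij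
    · rw [← hij, P.E_idem, P.trace_E]
    · rw [P.E_orth i j hij, Matrix.trace_zero]
  rw [h2] at h1
  have h3 : ∑ g, S.valency g * (P.Q g i * P.Q g j) =
      Fintype.card X * (if i = j then P.Q 0 i else 0) := by
    rw [h1]
    field_simp
  rw [h3]
  split_ifs <;> simp

theorem krein_zero_mid (P : PrimitiveIdempotents S) (i h : Fin (d + 1)) :
    P.krein i 0 h = if i = h then 1 else 0 := by
  have h1 := P.krein_eq i 0 h
  simp only [P.Q_zero_right, mul_one] at h1
  rw [P.sum_valency_mul_Q_mul_Q] at h1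
  have hn := S.card_pos.ne'
  have hm := (P.Q_zero_left_pos h).ne'
  apply mul_right_cancel₀ (mul_ne_zero hn hm)
  rw [h1]
  split_ifs with h2
  · rw [h2, one_mul]
  · rw [zero_mul]

theorem sum_Q (P : PrimitiveIdempotents S) (h : Fin (d + 1)) :
    ∑ j, P.Q h j = if h = 0 then (Fintype.card X : ℝ) else 0 := by
  obtain ⟨x, y, rfl⟩ := S.rel_nonempty h
  simp only [P.Q_rel]
  rw [← Finset.mul_sum, ← Matrix.sum_apply, P.E_sum, Matrix.one_apply]
  simp [S.rel_eq_zero_iff]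

theorem sum_krein (P : PrimitiveIdempotents S) (i h : Fin (d + 1)) :
    ∑ j, P.krein i j h = P.Q 0 i := by
  have hn := S.card_pos.ne'
  have hm := (P.Q_zero_left_pos h).ne'
  apply mul_right_cancel₀ (mul_ne_zero hn hm)
  rw [Finset.sum_mul, Finset.sum_congr rfl fun j _ => P.krein_eq i j h, Finset.sum_comm]
  have h1 : ∀ g, ∑ j, (S.valency g : ℝ) * (P.Q g i * P.Q g j * P.Q g h) =
      if g = 0 then Fintype.card X * (P.Q 0 i * P.Q 0 h) else 0 := by
    intro g
    rw [show ∑ j, (S.valency g : ℝ) * (P.Q g i * P.Q g j * P.Q g h) =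
      S.valency g * (P.Q g i * P.Q g h) * ∑ j, P.Q g j by
        rw [Finset.mul_sum]; exact Finset.sum_congr rfl fun j _ => by ring, P.sum_Q]
    split_ifs with hg
    · rw [hg, S.valency_zero]; push_cast; ring
    · rw [mul_zero]
  rw [Finset.sum_congr rfl fun g _ => h1 g, Finset.sum_ite_eq' Finset.univ 0]
  simp only [Finset.mem_univ, if_true]
  ring

theorem exists_adj_eq (P : PrimitiveIdempotents S) (h : Fin (d + 1)) :
    ∃ c : Fin (d + 1) → ℝ, S.adj h = ∑ l, c l • P.E l := by
  obtain ⟨c, hc⟩ := (Submodule.mem_span_range_iff_exists_fun ℝ).1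
    (P.mem_span (Submodule.subset_span ⟨h, rfl⟩))
  exact ⟨c, hc.symm⟩

/-- `A_h` acts on the range of `E_j` as a scalar, which is found by comparing traces. -/
theorem adj_mul_E (P : PrimitiveIdempotents S) (h j : Fin (d + 1)) :
    S.adj h * P.E j = (S.valency h * P.Q h j / P.Q 0 j) • P.E j := by
  obtain ⟨c, hc⟩ := P.exists_adj_eq h
  have h1 : S.adj h * P.E j = c j • P.E j := by
    rw [hc, Finset.sum_mul, Finset.sum_eq_single j]
    · rw [smul_mul_assoc, P.E_idem]
    · intro l _ hl
      rw [smul_mul_assoc, P.E_orth l j hl, smul_zero]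
    · simp
  have h2 : (S.adj h * P.E j).trace = S.valency h * P.Q h j := by
    have h3 : (S.adj h * P.E j).trace = (Fintype.card X : ℝ)⁻¹ *
        ∑ x, ∑ y, if S.rel x y = h then P.Q (S.rel x y) j else 0 := by
      simp only [Matrix.trace, Matrix.diag, Matrix.mul_apply, P.E_apply, Finset.mul_sum,
        AssociationScheme.adj, Matrix.of_apply]
      refine Finset.sum_congr rfl fun x _ => Finset.sum_congr rfl fun y _ => ?_
      rw [S.rel_symm y x]
      split_ifs <;> simp
    rw [h3, S.sum_sum_rel fun g => if g = h then P.Q g j else 0,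
      inv_mul_cancel_left₀ S.card_pos.ne']
    simp
  rw [h1, Matrix.trace_smul, P.trace_E, smul_eq_mul] at h2
  rw [h1, ← h2, mul_div_cancel_right₀ _ (P.Q_zero_left_pos j).ne']

theorem sum_rel_E (P : PrimitiveIdempotents S) (h j : Fin (d + 1)) (x z : X) :
    ∑ y, (if S.rel x y = h then P.E j y z else 0) =
      S.valency h * P.Q h j / P.Q 0 j * P.E j x z := by
  have h1 := congrFun (congrFun (P.adj_mul_E h j) x) z
  rw [Matrix.mul_apply, Matrix.smul_apply, smul_eq_mul] at h1
  rw [← h1]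
  refine Finset.sum_congr rfl fun y _ => ?_
  simp [AssociationScheme.adj]

theorem sum_rel_Q (P : PrimitiveIdempotents S) (h j : Fin (d + 1)) (x z : X) :
    ∑ y, (if S.rel x y = h then P.Q (S.rel y z) j else 0) =
      S.valency h * P.Q h j / P.Q 0 j * P.Q (S.rel x z) j := by
  rw [P.Q_rel j x z, mul_left_comm, ← P.sum_rel_E, Finset.mul_sum]
  refine Finset.sum_congr rfl fun y _ => ?_
  rw [P.Q_rel, mul_ite, mul_zero]

/-- The sum is, up to the factor `|X|`, the `(x, x)` entry of `A_h E_j A_g`. It gives the mean of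
column `j` over pairs of neighbours of `x`. -/
theorem sum_sum_rel_Q (P : PrimitiveIdempotents S) (h g j : Fin (d + 1)) (x : X) :
    ∑ y, ∑ z, (if S.rel x y = h ∧ S.rel x z = g then P.Q (S.rel y z) j else 0) =
      S.valency h * S.valency g * (P.Q h j * P.Q g j / P.Q 0 j) := by
  have hm := (P.Q_zero_left_pos j).ne'
  rw [Finset.sum_comm]
  have h1 : ∀ z, ∑ y, (if S.rel x y = h ∧ S.rel x z = g then P.Q (S.rel y z) j else 0) =
      if S.rel x z = g then S.valency h * P.Q h j / P.Q 0 j * P.Q g j else 0 := by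
    intro z
    by_cases hz : S.rel x z = g
    · simp only [hz, and_true, if_true]
      rw [P.sum_rel_Q, hz]
    · simp [hz]
  rw [Finset.sum_congr rfl fun z _ => h1 z,
    S.sum_rel (fun l => if l = g then S.valency h * P.Q h j / P.Q 0 j * P.Q g j else 0) x]
  simp only [mul_ite, mul_zero, Finset.sum_ite_eq', Finset.mem_univ, if_true]
  ring

/-- `A_h` is a combination of the `E_j`, so its entries depend only on the row of dual eigenvalues.
-/
theorem eq_of_Q_eq (P : PrimitiveIdempotents S) {h g : Fin (d + 1)}
    (hQ : ∀ j, P.Q h j = P.Q g j) : h = g := by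
  obtain ⟨c, hc⟩ := P.exists_adj_eq h
  obtain ⟨x, y, hxy⟩ := S.rel_nonempty h
  obtain ⟨x', y', hxy'⟩ := S.rel_nonempty g
  have h1 : S.adj h x y = S.adj h x' y' := by
    rw [hc, Matrix.sum_apply, Matrix.sum_apply]
    refine Finset.sum_congr rfl fun l _ => ?_
    rw [Matrix.smul_apply, Matrix.smul_apply, P.E_apply, P.E_apply, hxy, hxy', hQ]
  by_contra hne
  simp [AssociationScheme.adj, hxy, hxy', Ne.symm hne] at h1

/-- Squared norm of `E_j (e_x + ε e_y)`. The value `ε = -1` bounds the dual eigenvalues above, and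
`ε = 1` treats the extreme value `-Q 0 j`. -/
theorem sum_E_add_sq (P : PrimitiveIdempotents S) (j : Fin (d + 1)) (x y : X) (ε : ℝ) :
    ∑ z, (P.E j x z + ε * P.E j y z) ^ 2 =
      P.E j x x + 2 * ε * P.E j x y + ε ^ 2 * P.E j y y := by
  have h1 : ∀ x y, P.E j x y = ∑ z, P.E j x z * P.E j y z := by
    intro x y
    conv_lhs => rw [← P.E_idem j, Matrix.mul_apply]
    exact Finset.sum_congr rfl fun z _ => by rw [P.E_symm j z y]
  rw [h1 x x, h1 x y, h1 y y, Finset.mul_sum, Finset.mul_sum, ← Finset.sum_add_distrib,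
    ← Finset.sum_add_distrib]
  exact Finset.sum_congr rfl fun z _ => by ring

theorem Q_le (P : PrimitiveIdempotents S) (h j : Fin (d + 1)) : P.Q h j ≤ P.Q 0 j := by
  obtain ⟨x, y, rfl⟩ := S.rel_nonempty h
  have h1 : 0 ≤ ∑ z, (P.E j x z + (-1) * P.E j y z) ^ 2 :=
    Finset.sum_nonneg fun z _ => sq_nonneg _
  rw [P.sum_E_add_sq] at h1
  have hn := S.card_pos
  rw [P.Q_rel, ← S.rel_self x, P.Q_rel]
  have h2 : P.E j y y = P.E j x x := by rw [P.E_apply, P.E_apply, S.rel_self, S.rel_self]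
  rw [h2] at h1
  gcongr
  linarith

theorem Q_rel_eq_neg (P : PrimitiveIdempotents S) {j : Fin (d + 1)} {x y : X}
    (h : P.Q (S.rel x y) j = -P.Q 0 j) (z : X) :
    P.Q (S.rel x z) j = -P.Q (S.rel y z) j := by
  have h1 := P.sum_E_add_sq j x y 1
  have h2 : P.E j x x + 2 * 1 * P.E j x y + 1 ^ 2 * P.E j y y = 0 := by
    rw [P.E_apply, P.E_apply, P.E_apply, S.rel_self, S.rel_self, h]
    ring
  rw [h2, Finset.sum_eq_zero_iff_of_nonneg fun z _ => sq_nonneg _] at h1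
  have h3 := pow_eq_zero_iff (two_ne_zero) |>.1 (h1 z (Finset.mem_univ z))
  rw [P.Q_rel, P.Q_rel]
  linear_combination (Fintype.card X : ℝ) * h3

end PrimitiveIdempotents

/-! ### Labelling the four relations. -/

theorem Fin.univ_eq_of_ne {i j l : Fin 4} (hi : i ≠ 0) (hj : j ≠ 0) (hl : l ≠ 0) (hij : i ≠ j)
    (hil : i ≠ l) (hjl : j ≠ l) : (Finset.univ : Finset (Fin 4)) = {0, i, j, l} := by
  revert i j l
  decide

theorem Fin.sum_eq_of_ne {i j l : Fin 4} (hi : i ≠ 0) (hj : j ≠ 0) (hl : l ≠ 0) (hij : i ≠ j)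
    (hil : i ≠ l) (hjl : j ≠ l) (f : Fin 4 → ℝ) : ∑ h, f h = f 0 + f i + f j + f l := by
  rw [Fin.univ_eq_of_ne hi hj hl hij hil hjl, Finset.sum_insert, Finset.sum_insert,
    Finset.sum_insert, Finset.sum_singleton]
  · ring
  all_goals simp [*, Ne.symm]

theorem Fin.exists_strictAnti_of_injective {f : Fin 4 → ℝ} (hf : Function.Injective f) :
    ∃ i j l : Fin 4, i ≠ 0 ∧ j ≠ 0 ∧ l ≠ 0 ∧ f j < f i ∧ f l < f j := by
  have h12 : f 1 ≠ f 2 := hf.ne (by decide)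
  have h13 : f 1 ≠ f 3 := hf.ne (by decide)
  have h23 : f 2 ≠ f 3 := hf.ne (by decide)
  have n1 : (1 : Fin 4) ≠ 0 := by decide
  have n2 : (2 : Fin 4) ≠ 0 := by decide
  have n3 : (3 : Fin 4) ≠ 0 := by decide
  rcases lt_or_gt_of_ne h12 with a | a <;> rcases lt_or_gt_of_ne h13 with b | b <;>
    rcases lt_or_gt_of_ne h23 with c | c
  · exact ⟨3, 2, 1, n3, n2, n1, c, a⟩
  · exact ⟨2, 3, 1, n2, n3, n1, c, b⟩
  · linarith
  · exact ⟨2, 1, 3, n2, n1, n3, a, b⟩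
  · exact ⟨3, 1, 2, n3, n1, n2, b, a⟩
  · linarith
  · exact ⟨1, 3, 2, n1, n3, n2, b, c⟩
  · exact ⟨1, 2, 3, n1, n2, n3, a, c⟩

/-! ### Three-term recurrences in class 3 and the variance of the dual eigenvalue. -/

namespace QPolynomialStructure

variable {X : Type u} [Fintype X] [DecidableEq X] {S : AssociationScheme X 3}

theorem krein_one_one_zero (P : QPolynomialStructure S) : P.krein 1 1 0 = P.Q 0 1 := by
  have h1 := P.krein_mul_rotate 1 1 0
  rw [P.Q_zero_right, P.krein_comm 0 1 1, P.krein_zero_mid] at h1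
  simpa using h1

theorem krein_one_one_three (P : QPolynomialStructure S) : P.krein 1 1 3 = 0 :=
  (P.isQPolynomial 1 1 3).1 (by decide)

theorem krein_one_three_one (P : QPolynomialStructure S) : P.krein 1 3 1 = 0 :=
  (P.isQPolynomial 1 3 1).1 (by decide)

theorem krein_one_two_one_pos (P : QPolynomialStructure S) : 0 < P.krein 1 2 1 :=
  lt_of_le_of_ne (P.krein_nonneg 1 2 1) ((P.isQPolynomial 1 2 1).2 (by decide)).symm

theorem krein_one_one_two_pos (P : QPolynomialStructure S) : 0 < P.krein 1 1 2 :=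
  lt_of_le_of_ne (P.krein_nonneg 1 1 2) ((P.isQPolynomial 1 1 2).2 (by decide)).symm

theorem krein_one_two_three_pos (P : QPolynomialStructure S) : 0 < P.krein 1 2 3 :=
  lt_of_le_of_ne (P.krein_nonneg 1 2 3) ((P.isQPolynomial 1 2 3).2 (by decide)).symm

theorem Q_one_mul_Q_one (P : QPolynomialStructure S) (h : Fin 4) :
    P.Q h 1 * P.Q h 1 = P.Q 0 1 + P.krein 1 1 1 * P.Q h 1 + P.krein 1 1 2 * P.Q h 2 := by
  have h1 := P.Q_mul_Q h 1 1
  rw [Fin.sum_univ_four, P.krein_one_one_zero, P.Q_zero_right, P.krein_one_one_three] at h1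
  linear_combination h1

theorem Q_one_mul_Q_two (P : QPolynomialStructure S) (h : Fin 4) :
    P.Q h 1 * P.Q h 2 =
      P.krein 1 2 1 * P.Q h 1 + P.krein 1 2 2 * P.Q h 2 + P.krein 1 2 3 * P.Q h 3 := by
  have h1 := P.Q_mul_Q h 1 2
  rw [Fin.sum_univ_four, (P.isQPolynomial 1 2 0).1 (by decide)] at h1
  linear_combination h1

theorem Q_one_mul_Q_three (P : QPolynomialStructure S) (h : Fin 4) :
    P.Q h 1 * P.Q h 3 = P.krein 1 3 2 * P.Q h 2 + P.krein 1 3 3 * P.Q h 3 := by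
  have h1 := P.Q_mul_Q h 1 3
  rw [Fin.sum_univ_four, (P.isQPolynomial 1 3 0).1 (by decide), P.krein_one_three_one] at h1
  linear_combination h1

theorem one_add_krein (P : QPolynomialStructure S) :
    1 + P.krein 1 1 1 + P.krein 1 2 1 = P.Q 0 1 := by
  have h1 := P.sum_krein 1 1
  rw [Fin.sum_univ_four, P.krein_zero_mid, P.krein_one_three_one, if_pos rfl] at h1
  linear_combination h1

theorem krein_one_two_sum (P : QPolynomialStructure S) :
    P.krein 1 1 2 + P.krein 1 2 2 + P.krein 1 3 2 = P.Q 0 1 := by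
  have h1 := P.sum_krein 1 2
  rw [Fin.sum_univ_four, P.krein_zero_mid, if_neg (by decide)] at h1
  linear_combination h1

theorem krein_one_three_sum (P : QPolynomialStructure S) :
    P.krein 1 2 3 + P.krein 1 3 3 = P.Q 0 1 := by
  have h1 := P.sum_krein 1 3
  rw [Fin.sum_univ_four, P.krein_zero_mid, if_neg (by decide), P.krein_one_one_three] at h1
  linear_combination h1

theorem krein_one_one_two_mul (P : QPolynomialStructure S) :
    P.krein 1 1 2 * P.Q 0 2 = P.krein 1 2 1 * P.Q 0 1 := by
  rw [P.krein_mul_rotate, P.krein_comm]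

theorem krein_one_two_three_mul (P : QPolynomialStructure S) :
    P.krein 1 2 3 * P.Q 0 3 = P.krein 1 3 2 * P.Q 0 2 := by
  rw [P.krein_comm, P.krein_mul_rotate, P.krein_comm]

/-- The dual eigenvalues of a `Q`-polynomial scheme are distinct. -/
theorem Q_one_injective (P : QPolynomialStructure S) :
    Function.Injective fun h => P.Q h 1 := by
  intro h g hg
  replace hg : P.Q h 1 = P.Q g 1 := hg
  have h2 : P.Q h 2 = P.Q g 2 := by
    apply mul_left_cancel₀ P.krein_one_one_two_pos.ne'
    have e1 := P.Q_one_mul_Q_one h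
    have e2 := P.Q_one_mul_Q_one g
    rw [hg] at e1
    linear_combination e2 - e1
  have h3 : P.Q h 3 = P.Q g 3 := by
    apply mul_left_cancel₀ P.krein_one_two_three_pos.ne'
    have e1 := P.Q_one_mul_Q_two h
    have e2 := P.Q_one_mul_Q_two g
    rw [hg, h2] at e1
    linear_combination e2 - e1
  refine P.eq_of_Q_eq fun j => ?_
  fin_cases j
  · exact (P.Q_zero_right h).trans (P.Q_zero_right g).symm
  · exact hg
  · exact h2
  · exact h3

theorem Q_one_lt (P : QPolynomialStructure S) {h : Fin 4} (hh : h ≠ 0) : P.Q h 1 < P.Q 0 1 :=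
  lt_of_le_of_ne (P.Q_le h 1) (P.Q_one_injective.ne hh)

/-- The variance of the dual eigenvalue `θ_{yz}` over `y ∈ R_i(x)`, `z ∈ R_j(x)`. -/
theorem sum_sum_sq_sub (P : QPolynomialStructure S) (i j : Fin 4) (x : X) :
    ∑ y, ∑ z, (if S.rel x y = i ∧ S.rel x z = j then
        (P.Q (S.rel y z) 1 - P.Q i 1 * P.Q j 1 / P.Q 0 1) ^ 2 else 0) =
      S.valency i * S.valency j * (((P.krein 1 1 1 + 1) * (P.Q i 1 * P.Q j 1) +
        P.Q 0 1 * (P.Q i 1 + P.Q j 1) + P.Q 0 1 * (P.krein 1 2 1 + 1)) *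
        ((P.Q 0 1 - P.Q i 1) * (P.Q 0 1 - P.Q j 1)) / (P.krein 1 2 1 * P.Q 0 1 ^ 2)) := by
  set m := P.Q 0 1 with hm
  set τ := P.Q i 1 * P.Q j 1 / m with hτ
  have hm0 : m ≠ 0 := (P.Q_zero_left_pos 1).ne'
  have hm2 : P.Q 0 2 ≠ 0 := (P.Q_zero_left_pos 2).ne'
  have hb : P.krein 1 2 1 ≠ 0 := P.krein_one_two_one_pos.ne'
  have hc : P.krein 1 1 2 ≠ 0 := P.krein_one_one_two_pos.ne'
  -- By the recurrence for `Q · 1`, the squared deviation is linear in columns 0, 1 and 2, whose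
  -- sums `sum_sum_rel_Q` supplies.
  have h1 : ∀ y z, (if S.rel x y = i ∧ S.rel x z = j then
        (P.Q (S.rel y z) 1 - τ) ^ 2 else 0) =
      (m + τ ^ 2) * (if S.rel x y = i ∧ S.rel x z = j then P.Q (S.rel y z) 0 else 0) +
      (P.krein 1 1 1 - 2 * τ) *
        (if S.rel x y = i ∧ S.rel x z = j then P.Q (S.rel y z) 1 else 0) +
      P.krein 1 1 2 * (if S.rel x y = i ∧ S.rel x z = j then P.Q (S.rel y z) 2 else 0) := by
    intro y z
    split_ifs
    · rw [P.Q_zero_right]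
      linear_combination P.Q_one_mul_Q_one (S.rel y z)
    · ring
  simp only [h1, Finset.sum_add_distrib, ← Finset.mul_sum]
  rw [P.sum_sum_rel_Q, P.sum_sum_rel_Q, P.sum_sum_rel_Q, P.Q_zero_right, P.Q_zero_right,
    P.Q_zero_right, ← hm]
  have h2 : P.krein 1 1 2 * (P.Q i 2 * P.Q j 2 / P.Q 0 2) =
      (P.Q i 1 * P.Q i 1 - m - P.krein 1 1 1 * P.Q i 1) *
        (P.Q j 1 * P.Q j 1 - m - P.krein 1 1 1 * P.Q j 1) / (P.krein 1 2 1 * m) := by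
    rw [← P.krein_one_one_two_mul, P.Q_one_mul_Q_one i, P.Q_one_mul_Q_one j, ← hm]
    field_simp
    ring
  have h3 : ∀ k l r : ℝ, P.krein 1 1 2 * (k * l * r) = k * l * (P.krein 1 1 2 * r) := by
    intros; ring
  rw [h3, h2, hτ]
  have h4 : m = 1 + P.krein 1 1 1 + P.krein 1 2 1 := P.one_add_krein.symm
  have h5 : P.krein 1 1 1 = m - 1 - P.krein 1 2 1 := by linarith
  rw [h5]
  field_simp
  ring

theorem rel_eq_of_tight (P : QPolynomialStructure S) {i j : Fin 4}
    (hG : (P.krein 1 1 1 + 1) * (P.Q i 1 * P.Q j 1) +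
        P.Q 0 1 * (P.Q i 1 + P.Q j 1) + P.Q 0 1 * (P.krein 1 2 1 + 1) = 0) {x y z : X}
    (hy : S.rel x y = i) (hz : S.rel x z = j) :
    P.Q (S.rel y z) 1 = P.Q i 1 * P.Q j 1 / P.Q 0 1 := by
  have h1 := P.sum_sum_sq_sub i j x
  rw [hG, zero_mul, zero_div, mul_zero] at h1
  have h0 : ∀ y z, 0 ≤ (if S.rel x y = i ∧ S.rel x z = j then
        (P.Q (S.rel y z) 1 - P.Q i 1 * P.Q j 1 / P.Q 0 1) ^ 2 else 0) := by
    intro y z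
    split_ifs
    · exact sq_nonneg _
    · exact le_rfl
  rw [Finset.sum_eq_zero_iff_of_nonneg fun y _ => Finset.sum_nonneg fun z _ => h0 y z] at h1
  have h2 := h1 y (Finset.mem_univ y)
  rw [Finset.sum_eq_zero_iff_of_nonneg fun z _ => h0 y z] at h2
  have h3 := h2 z (Finset.mem_univ z)
  rw [if_pos ⟨hy, hz⟩, sq_eq_zero_iff] at h3
  linarith

/-- Average the cubic vanishing at `m`, `θ_i`, `θ_l` over the relations: only `R_j` contributes,
while the moments of orders 0 to 3 are known. -/
theorem valency_mul_prod (P : QPolynomialStructure S) {i j l : Fin 4} (hi : i ≠ 0) (hj : j ≠ 0)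
    (hl : l ≠ 0) (hij : i ≠ j) (hil : i ≠ l) (hjl : j ≠ l) :
    S.valency j * ((P.Q j 1 - P.Q 0 1) * (P.Q j 1 - P.Q i 1) * (P.Q j 1 - P.Q l 1)) =
      -(Fintype.card X * P.Q 0 1 * (P.krein 1 2 1 + (1 + P.Q i 1) * (1 + P.Q l 1))) := by
  have h0 := P.sum_valency_mul_Q_mul_Q 0 0
  have h1 := P.sum_valency_mul_Q_mul_Q 1 0
  have h2 := P.sum_valency_mul_Q_mul_Q 1 1
  have h3 := P.krein_eq 1 1 1
  rw [Fin.sum_eq_of_ne hi hj hl hij hil hjl] at h0 h1 h2 h3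
  rw [if_pos rfl] at h0 h2
  rw [if_neg (by decide)] at h1
  simp only [P.Q_zero_right, mul_one] at h0 h1
  have h4 := P.one_add_krein
  linear_combination -h3 - (P.Q 0 1 + P.Q i 1 + P.Q l 1) * h2 +
    (P.Q 0 1 * P.Q i 1 + P.Q 0 1 * P.Q l 1 + P.Q i 1 * P.Q l 1) * h1 -
    P.Q 0 1 * P.Q i 1 * P.Q l 1 * h0 + Fintype.card X * P.Q 0 1 * h4

end QPolynomialStructure

/-! ### Krein parameters of a tight scheme. -/

/-- Vieta's formulas for a monic cubic with three distinct roots. -/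
theorem cubic_vieta {x y z p q r : ℝ} (hxy : x ≠ y) (hxz : x ≠ z) (hyz : y ≠ z)
    (hx : x ^ 3 + p * x ^ 2 + q * x + r = 0) (hy : y ^ 3 + p * y ^ 2 + q * y + r = 0)
    (hz : z ^ 3 + p * z ^ 2 + q * z + r = 0) :
    p = -(x + y + z) ∧ q = x * y + x * z + y * z ∧ r = -(x * y * z) := by
  have e1 : x ^ 2 + x * y + y ^ 2 + p * (x + y) + q = 0 := by
    apply mul_left_cancel₀ (sub_ne_zero.2 hxy)
    linear_combination hx - hy
  have e2 : x ^ 2 + x * z + z ^ 2 + p * (x + z) + q = 0 := by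
    apply mul_left_cancel₀ (sub_ne_zero.2 hxz)
    linear_combination hx - hz
  have hp : p = -(x + y + z) := by
    apply mul_left_cancel₀ (sub_ne_zero.2 hyz)
    linear_combination e1 - e2
  have hq : q = x * y + x * z + y * z := by
    rw [hp] at e1
    linear_combination e1
  refine ⟨hp, hq, ?_⟩
  rw [hp, hq] at hx
  linear_combination hx

/-- A tridiagonal `4 × 4` matrix with constant row sum `m`, with `b₀ = m` and `c₁ = 1`, whose
eigenvalues `θ₁`, `θ₃` satisfy the tightness equation and `m θ₂ = θ₁ θ₃`. -/
theorem tridiagonal_of_tight {m b c₂ b₂ c₃ x t z : ℝ} (hb : b ≠ 0) (hc₂ : c₂ ≠ 0)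
    (hm : m ≠ 0) (hxt : x ≠ t) (hxz : x ≠ z) (htz : t ≠ z)
    (hf : ∀ w, w = x ∨ w = t ∨ w = z →
      (w + 1) * ((w - (m - b - c₂)) * (w - (m - b₂ - c₃)) - b₂ * c₂) -
        b * (w - (m - b₂ - c₃)) = 0)
    (ht : m * t = x * z) (hG : (m - b) * (x * z) + m * (x + z) + m * (b + 1) = 0) :
    c₃ = m ∧ b₂ = t ^ 2 ∧ c₂ = m + (m - 1 - b) * t - t ^ 2 := by
  have hG' : (m - b) * t + (x + z) + (b + 1) = 0 := by
    apply mul_left_cancel₀ hm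
    linear_combination hG + (m - b) * ht
  obtain ⟨d, hd⟩ : ∃ d, d = m - b₂ - c₃ := ⟨_, rfl⟩
  rw [← hd] at hf
  have key : ∀ w, w = x ∨ w = t ∨ w = z →
      w ^ 3 + (1 - (m - b - c₂) - d) * w ^ 2 +
        ((m - b - c₂) * d - b₂ * c₂ - (m - b - c₂) - d - b) * w +
        ((m - b - c₂) * d - b₂ * c₂ + b * d) = 0 := by
    intro w hw
    linear_combination hf w hw
  obtain ⟨h1, h2, h3⟩ := cubic_vieta hxt hxz htz (key x (by simp)) (key t (by simp))
    (key z (by simp))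
  -- The alternating sum of the Vieta relations evaluates the cubic at `-1`: `b (1 + d) = -(1 + x)(1
  -- + t)(1 + z)`. Tightness and `ht` turn `(1 + x)(1 + z)` into `b (t - 1)`.
  have h4 : d = -t ^ 2 := by
    apply mul_left_cancel₀ hb
    linear_combination h1 - h2 + h3 + (1 + t) * ht - (1 + t) * hG'
  have h5 : b₂ = t ^ 2 := by
    apply mul_left_cancel₀ hc₂
    rw [h4] at h3
    linear_combination -h3 - t * ht
  refine ⟨?_, h5, ?_⟩
  · rw [h4, h5] at hd
    linear_combination hd
  · rw [h4] at h1
    linear_combination h1 - hG'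

namespace PrimitiveIdempotents

variable {X : Type u} [Fintype X] [DecidableEq X] {d : ℕ} {S : AssociationScheme X d}

theorem sum_valency_mul_four (P : PrimitiveIdempotents S) (i j p r : Fin (d + 1)) :
    ∑ g, S.valency g * (P.Q g i * P.Q g j * (P.Q g p * P.Q g r)) =
      Fintype.card X * ∑ l, P.krein i j l * P.krein p r l * P.Q 0 l := by
  simp only [P.Q_mul_Q _ i j, Finset.sum_mul, Finset.mul_sum]
  rw [Finset.sum_comm]
  refine Finset.sum_congr rfl fun l _ => ?_
  have h1 := P.krein_eq p r l
  rw [show (Fintype.card X : ℝ) * (P.krein i j l * P.krein p r l * P.Q 0 l) =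
    P.krein i j l * (P.krein p r l * (Fintype.card X * P.Q 0 l)) by ring, h1, Finset.mul_sum]
  exact Finset.sum_congr rfl fun g _ => by ring

/-- Associativity and commutativity of the entrywise product, read off from sums of four dual
eigenvalues. -/
theorem sum_krein_mul_krein (P : PrimitiveIdempotents S) (i j p r : Fin (d + 1)) :
    ∑ l, P.krein i j l * P.krein p r l * P.Q 0 l =
      ∑ l, P.krein i p l * P.krein j r l * P.Q 0 l := by
  apply mul_left_cancel₀ S.card_pos.ne'
  rw [← P.sum_valency_mul_four, ← P.sum_valency_mul_four]
  exact Finset.sum_congr rfl fun g _ => by ring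

end PrimitiveIdempotents

namespace QPolynomialStructure

variable {X : Type u} [Fintype X] [DecidableEq X] {S : AssociationScheme X 3}

/-- Eliminating columns 2 and 3 from the recurrences gives the quartic characteristic equation of
the tridiagonal Krein matrix. The constant row sum `m` is a root, and its factor is cancelled since
`θ_h ≠ m`. -/
theorem charpoly_eq_zero (P : QPolynomialStructure S) {h : Fin 4} (hh : h ≠ 0) :
    (P.Q h 1 + 1) * ((P.Q h 1 - (P.Q 0 1 - P.krein 1 2 1 - P.krein 1 1 2)) *
        (P.Q h 1 - (P.Q 0 1 - P.krein 1 3 2 - P.krein 1 2 3)) -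
          P.krein 1 3 2 * P.krein 1 1 2) -
      P.krein 1 2 1 * (P.Q h 1 - (P.Q 0 1 - P.krein 1 3 2 - P.krein 1 2 3)) = 0 := by
  have e1 := P.Q_one_mul_Q_one h
  have e2 := P.Q_one_mul_Q_two h
  have e3 := P.Q_one_mul_Q_three h
  rw [show P.krein 1 1 1 = P.Q 0 1 - 1 - P.krein 1 2 1 by linarith [P.one_add_krein]] at e1
  rw [show P.krein 1 2 2 = P.Q 0 1 - P.krein 1 1 2 - P.krein 1 3 2 by
    linarith [P.krein_one_two_sum]] at e2
  rw [show P.krein 1 3 3 = P.Q 0 1 - P.krein 1 2 3 by linarith [P.krein_one_three_sum]] at e3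
  apply mul_left_cancel₀ (sub_ne_zero.2 (P.Q_one_lt hh).ne)
  generalize P.krein 1 2 1 = b at *
  generalize P.krein 1 1 2 = c at *
  generalize P.krein 1 3 2 = b₂ at *
  generalize P.krein 1 2 3 = c₃ at *
  generalize P.Q 0 1 = m at *
  generalize P.Q h 1 = t at *
  generalize P.Q h 2 = q at *
  generalize P.Q h 3 = r at *
  linear_combination ((t - (m - c₃)) * (t - (m - c - b₂)) - b₂ * c₃) * e1 +
    c * (t - (m - c₃)) * e2 + c * c₃ * e3

/-- In the situation produced by tightness the middle dual eigenvalue is `-1`. -/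
theorem mid_eq_neg_one (P : QPolynomialStructure S) {t : ℝ} (ht : t < 0)
    (ha : 0 < P.krein 1 1 1) (hc₃ : P.krein 1 2 3 = P.Q 0 1) (hb₂ : P.krein 1 3 2 = t ^ 2)
    (hc₂ : P.krein 1 1 2 = P.Q 0 1 + P.krein 1 1 1 * t - t ^ 2) : t = -1 := by
  have hm := P.Q_zero_left_pos 1
  have hm2 := P.Q_zero_left_pos 2
  have hm3 := P.Q_zero_left_pos 3
  have hc2 := P.krein_one_one_two_pos
  have s1 := P.one_add_krein
  have r2 := P.krein_one_one_two_mul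
  have r3 := P.krein_one_two_three_mul
  have ha₃ : P.krein 1 3 3 = 0 := by linarith [P.krein_one_three_sum]
  have h331 : P.krein 3 3 1 = 0 := by
    have := P.krein_mul_rotate 3 3 1
    rw [ha₃, zero_mul] at this
    exact (mul_eq_zero.1 this).resolve_right hm.ne'
  have h330 : P.krein 3 3 0 = P.Q 0 3 := by
    have := P.krein_mul_rotate 3 3 0
    rw [P.Q_zero_right, P.krein_comm 0 3 3, P.krein_zero_mid] at this
    simpa using this
  have h332 := P.krein_mul_rotate 3 3 2
  -- As `a_3^* = 0`, few terms survive: `m m₃ + c L m₂ = t⁴ m₂`.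
  have hassoc := P.sum_krein_mul_krein 1 1 3 3
  rw [Fin.sum_univ_four, Fin.sum_univ_four, h331, h330, P.krein_one_one_zero,
    P.krein_one_one_three, P.krein_one_three_one, ha₃, (P.isQPolynomial 1 3 0).1 (by decide),
    P.Q_zero_right, hb₂] at hassoc
  have hsum := P.sum_krein 3 3
  rw [Fin.sum_univ_four, P.krein_zero_mid, if_pos rfl, P.krein_comm 3 1 3, ha₃,
    P.krein_comm 3 2 3] at hsum
  have g0 := P.krein_nonneg 2 3 3
  have g1 := P.krein_nonneg 3 3 3
  rw [hc₃, hb₂] at r3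
  generalize P.krein 2 3 3 = G at *
  generalize P.krein 3 3 3 = K at *
  generalize P.krein 3 3 2 = L at *
  generalize P.krein 1 1 1 = a at *
  generalize P.krein 1 2 1 = b at *
  generalize P.Q 0 1 = m at *
  generalize P.Q 0 2 = m₂ at *
  generalize P.Q 0 3 = m₃ at *
  generalize P.krein 1 1 2 = c at *
  have e1 : m * (t ^ 2 - 1) = c * G := by
    apply mul_left_cancel₀ hm3.ne'
    linear_combination -hassoc + c * h332 + t ^ 2 * r3
  have e0 : m₃ * c = b * t ^ 2 := by
    apply mul_left_cancel₀ hm.ne'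
    linear_combination c * r3 + t ^ 2 * r2
  have e2 : c * K = -(a * t * (t + 1)) := by
    have : K = m₃ - 1 - G := by linarith
    rw [this]
    linear_combination e0 + e1 - hc₂ + t ^ 2 * s1
  -- Nonnegativity of `q_{2,3}^3` gives `t² ≥ 1`, that of `q_{3,3}^3` gives `t ≥ -1`; with `t < 0`
  -- only `-1` is left.
  have f1 : 0 ≤ t ^ 2 - 1 := by
    have : 0 ≤ m * (t ^ 2 - 1) := e1 ▸ mul_nonneg hc2.le g0
    exact nonneg_of_mul_nonneg_right this hm
  have f2 : 0 ≤ t + 1 := by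
    have h1 : 0 ≤ (a * -t) * (t + 1) := by
      have := mul_nonneg hc2.le g1
      linarith
    exact nonneg_of_mul_nonneg_right h1 (mul_pos ha (neg_pos.2 ht))
  nlinarith

/-- The third column of the matrix of dual eigenvalues of a tight scheme, with respect to the
labelling of the relations by decreasing dual eigenvalues. -/
theorem Q_three_of_tight (P : QPolynomialStructure S) {i j l : Fin 4} (hi : i ≠ 0) (hj : j ≠ 0)
    (hl : l ≠ 0) (hij : P.Q j 1 < P.Q i 1) (hjl : P.Q l 1 < P.Q j 1)
    (ha : 0 < P.krein 1 1 1)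
    (hG : (P.krein 1 1 1 + 1) * (P.Q i 1 * P.Q l 1) +
        P.Q 0 1 * (P.Q i 1 + P.Q l 1) + P.Q 0 1 * (P.krein 1 2 1 + 1) = 0) :
    P.Q 0 3 = 1 ∧ P.Q i 3 = -1 ∧ P.Q j 3 = 1 ∧ P.Q l 3 = -1 ∧ 0 < P.Q i 1 ∧
      P.Q i 1 * P.Q l 1 = -P.Q 0 1 ∧ P.Q i 1 + P.Q l 1 = P.krein 1 1 1 - P.krein 1 2 1 := by
  have nij : i ≠ j := fun e => hij.ne (by rw [e])
  have njl : j ≠ l := fun e => hjl.ne (by rw [e])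
  have nil : i ≠ l := fun e => (hjl.trans hij).ne (by rw [e])
  have hm := P.Q_zero_left_pos 1
  have hb := P.krein_one_two_one_pos
  have s1 := P.one_add_krein
  have hi1 := P.Q_one_lt hi
  have hj1 := P.Q_one_lt hj
  have hk := P.valency_mul_prod hi hj hl nij nil njl
  -- The left side of `hk` is positive because `θ_j` is the middle value, and tightness rewrites the
  -- right side as `-|X| b θ_i θ_l`.
  have hP : P.Q i 1 * P.Q l 1 < 0 := by
    have h1 : 0 < S.valency j *
        ((P.Q j 1 - P.Q 0 1) * (P.Q j 1 - P.Q i 1) * (P.Q j 1 - P.Q l 1)) := by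
      have := S.valency_pos j
      have h2 : 0 < (P.Q j 1 - P.Q 0 1) * (P.Q j 1 - P.Q i 1) :=
        mul_pos_of_neg_of_neg (by linarith) (by linarith)
      have h3 : 0 < P.Q j 1 - P.Q l 1 := by linarith
      positivity
    rw [hk] at h1
    have h4 : Fintype.card X * P.Q 0 1 * (P.krein 1 2 1 + (1 + P.Q i 1) * (1 + P.Q l 1)) =
        Fintype.card X * P.krein 1 2 1 * (P.Q i 1 * P.Q l 1) := by
      linear_combination (Fintype.card X : ℝ) * hG - Fintype.card X * (P.Q i 1 * P.Q l 1) * s1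
    rw [h4] at h1
    have h5 := mul_pos S.card_pos hb
    by_contra hcon
    have := mul_nonneg h5.le (not_lt.1 hcon)
    linarith
  have hi0 : 0 < P.Q i 1 := by
    by_contra hcon
    have := mul_nonneg_of_nonpos_of_nonpos (not_lt.1 hcon)
      (((hjl.trans hij).le).trans (not_lt.1 hcon))
    linarith
  have hl0 : P.Q l 1 < 0 := by
    by_contra hcon
    have := mul_nonneg hi0.le (not_lt.1 hcon)
    linarith
  -- The quotient is a dual eigenvalue by zero variance. It is negative and, since `θ_i < m`, larger
  -- than `θ_l`, so only `θ_j` remains.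
  have ht : P.Q j 1 = P.Q i 1 * P.Q l 1 / P.Q 0 1 := by
    obtain ⟨x, -⟩ := S.rel_nonempty 0
    obtain ⟨y, hy⟩ := S.exists_rel i x
    obtain ⟨z, hz⟩ := S.exists_rel l x
    have h1 := P.rel_eq_of_tight hG hy hz
    have h2 : P.Q i 1 * P.Q l 1 / P.Q 0 1 < 0 := div_neg_of_neg_of_pos hP hm
    have h3 : P.Q l 1 < P.Q i 1 * P.Q l 1 / P.Q 0 1 := by
      rw [lt_div_iff₀ hm]
      nlinarith
    have h4 := Finset.mem_univ (S.rel y z)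
    rw [Fin.univ_eq_of_ne hi hj hl nij nil njl] at h4
    simp only [Finset.mem_insert, Finset.mem_singleton] at h4
    rcases h4 with h | h | h | h <;> rw [h] at h1
    · linarith
    · linarith
    · exact h1
    · linarith
  have hmt : P.Q 0 1 * P.Q j 1 = P.Q i 1 * P.Q l 1 := by
    rw [ht]
    field_simp
  have hj0 : P.Q j 1 < 0 := by rw [ht]; exact div_neg_of_neg_of_pos hP hm
  have ha' : P.krein 1 1 1 = P.Q 0 1 - 1 - P.krein 1 2 1 := by linarith
  obtain ⟨hc₃, hb₂, hc₂⟩ := tridiagonal_of_tight hb.ne' P.krein_one_one_two_pos.ne' hm.ne'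
    hij.ne' (hjl.trans hij).ne' hjl.ne' (c₃ := P.krein 1 2 3) (b₂ := P.krein 1 3 2)
    (c₂ := P.krein 1 1 2)
    (by rintro w (rfl | rfl | rfl) <;> exact P.charpoly_eq_zero ‹_›) hmt
    (by rw [ha'] at hG; linear_combination hG)
  rw [← ha'] at hc₂
  have htt := P.mid_eq_neg_one hj0 ha hc₃ hb₂ hc₂
  rw [htt] at hc₂ hb₂ hmt
  have hcb : P.krein 1 1 2 = P.krein 1 2 1 := by linarith
  have hs : P.Q i 1 + P.Q l 1 = P.krein 1 1 1 - P.krein 1 2 1 := by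
    apply mul_left_cancel₀ hm.ne'
    linear_combination hG + (P.krein 1 1 1 + 1) * hmt
  have ha₃ : P.krein 1 3 3 = 0 := by linarith [P.krein_one_three_sum]
  -- Now `a_3^* = 0` and `b_2^* = 1`, so `Q h 1 * Q h 3 = Q h 2`, and the first recurrence
  -- determines `Q h 3` wherever `θ_h ≠ 0`.
  have h12 : ∀ h, P.krein 1 2 1 * (P.Q h 1 * P.Q h 3) =
      P.Q h 1 * P.Q h 1 - P.Q 0 1 - P.krein 1 1 1 * P.Q h 1 := by
    intro h
    rw [P.Q_one_mul_Q_three, ha₃, hb₂, ← hcb]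
    linear_combination -P.Q_one_mul_Q_one h
  have hne : ∀ h, P.Q h 1 ≠ 0 → ∀ v, P.Q h 1 * P.Q h 1 - P.Q 0 1 - P.krein 1 1 1 * P.Q h 1 =
      P.krein 1 2 1 * (P.Q h 1 * v) → P.Q h 3 = v := by
    intro h h0 v hv
    exact mul_left_cancel₀ h0 (mul_left_cancel₀ hb.ne' ((h12 h).trans hv))
  refine ⟨hne 0 hm.ne' _ ?_, hne i hi0.ne' _ ?_, hne j hj0.ne _ ?_, hne l hl0.ne _ ?_, hi0,
    by linarith, hs⟩
  · linear_combination -P.Q 0 1 * s1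
  · linear_combination P.Q i 1 * hs + hmt
  · rw [htt]; linear_combination s1
  · linear_combination P.Q l 1 * hs + hmt

/-- If `-m` is a dual eigenvalue and `a_1^* = 0`, the scheme is `Q`-bipartite. -/
theorem isQBipartite_of_eq_neg (P : QPolynomialStructure S) (ha : P.krein 1 1 1 = 0)
    {i : Fin 4} (hi : P.Q i 1 = -P.Q 0 1) : P.IsQBipartite := by
  obtain ⟨x, y, rfl⟩ := S.rel_nonempty i
  have h1 := P.Q_rel_eq_neg hi
  have h2 : ∀ z, P.Q (S.rel x z) 2 = P.Q (S.rel y z) 2 := by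
    intro z
    apply mul_left_cancel₀ P.krein_one_one_two_pos.ne'
    have e1 := P.Q_one_mul_Q_one (S.rel x z)
    have e2 := P.Q_one_mul_Q_one (S.rel y z)
    rw [ha, h1 z] at e1
    rw [ha] at e2
    linear_combination e2 - e1
  -- The sum over `z` does not depend on the base point, yet replacing `x` by `y` negates it, so it
  -- is zero.
  have odd : ∀ j, (∀ z, P.Q (S.rel x z) 1 * P.Q (S.rel x z) j * P.Q (S.rel x z) j =
      -(P.Q (S.rel y z) 1 * P.Q (S.rel y z) j * P.Q (S.rel y z) j)) → P.krein 1 j j = 0 := by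
    intro j hj
    have e1 := P.krein_eq 1 j j
    have e2 := S.sum_rel (fun g => P.Q g 1 * P.Q g j * P.Q g j) x
    have e3 := S.sum_rel (fun g => P.Q g 1 * P.Q g j * P.Q g j) y
    simp only [hj, Finset.sum_neg_distrib] at e2
    have e4 : P.krein 1 j j * (Fintype.card X * P.Q 0 j) = 0 := by linarith
    exact (mul_eq_zero.1 e4).resolve_right
      (mul_ne_zero S.card_pos.ne' (P.Q_zero_left_pos j).ne')
  have a2 : P.krein 1 2 2 = 0 := odd 2 fun z => by rw [h1, h2]; ring
  have h3 : ∀ z, P.Q (S.rel x z) 3 = -P.Q (S.rel y z) 3 := by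
    intro z
    apply mul_left_cancel₀ P.krein_one_two_three_pos.ne'
    have e1 := P.Q_one_mul_Q_two (S.rel x z)
    have e2 := P.Q_one_mul_Q_two (S.rel y z)
    rw [a2, h1 z, h2 z] at e1
    rw [a2] at e2
    linear_combination -e2 - e1
  have a3 : P.krein 1 3 3 = 0 := odd 3 fun z => by rw [h1, h3]; ring
  intro j
  fin_cases j
  · exact (P.krein_zero_mid 1 0).trans (if_neg (by decide))
  · exact ha
  · exact a2
  · exact a3

end QPolynomialStructure

/-! ### From dual-tight to a symmetric design. -/

/-- The right-hand form is the factor occurring in the variance formula `sum_sum_sq_sub`. -/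
theorem tight_equation_iff {m a b p r : ℝ} (ha : 0 ≤ a) (hm : 1 + a + b = m) :
    (p + m / (a + 1)) * (r + m / (a + 1)) = -(m * a * b / (a + 1) ^ 2) ↔
      (a + 1) * (p * r) + m * (p + r) + m * (b + 1) = 0 := by
  have h1 : a + 1 ≠ 0 := by positivity
  have h2 : (p + m / (a + 1)) * (r + m / (a + 1)) + m * a * b / (a + 1) ^ 2 =
      ((a + 1) * (p * r) + m * (p + r) + m * (b + 1)) / (a + 1) := by
    rw [← hm]
    field_simp
    ring
  rw [eq_neg_iff_add_eq_zero, h2, div_eq_zero_iff]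
  simp [h1]

namespace PrimitiveIdempotents

variable {X : Type u} [Fintype X] [DecidableEq X] {d : ℕ} {S : AssociationScheme X d}

/-- An idempotent with entries `± 1 / |X|` is multiplicative along paths. -/
theorem Q_mul_Q_of_sq_eq_one (P : PrimitiveIdempotents S) {j : Fin (d + 1)}
    (hj : ∀ h, P.Q h j ^ 2 = 1) (x z y : X) :
    P.Q (S.rel x z) j * P.Q (S.rel z y) j = P.Q (S.rel x y) j := by
  have h1 : ∑ z, P.Q (S.rel x z) j * P.Q (S.rel z y) j = Fintype.card X * P.Q (S.rel x y) j := by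
    rw [P.Q_rel j x y]
    conv_rhs => rw [← P.E_idem j, Matrix.mul_apply, ← mul_assoc, Finset.mul_sum]
    exact Finset.sum_congr rfl fun z _ => by rw [P.Q_rel, P.Q_rel]; ring
  -- By `h1`, the `|X|` terms `±1` have average `Q (S.rel x y) j`, which is itself `±1`, so every
  -- term equals it.
  have h2 : ∑ z, (P.Q (S.rel x z) j * P.Q (S.rel z y) j - P.Q (S.rel x y) j) ^ 2 = 0 := by
    have h3 : ∀ z, (P.Q (S.rel x z) j * P.Q (S.rel z y) j - P.Q (S.rel x y) j) ^ 2 =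
        2 - 2 * P.Q (S.rel x y) j * (P.Q (S.rel x z) j * P.Q (S.rel z y) j) := by
      intro z
      linear_combination P.Q (S.rel x z) j ^ 2 * hj (S.rel z y) + hj (S.rel x z) +
        hj (S.rel x y)
    simp only [h3]
    rw [Finset.sum_sub_distrib, ← Finset.mul_sum, h1, Finset.sum_const, Finset.card_univ,
      nsmul_eq_mul]
    linear_combination -2 * (Fintype.card X : ℝ) * hj (S.rel x y)
  rw [Finset.sum_eq_zero_iff_of_nonneg fun z _ => sq_nonneg _] at h2
  exact sub_eq_zero.1 (pow_eq_zero_iff two_ne_zero |>.1 (h2 z (Finset.mem_univ z)))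

/-- `A_h` is then a symmetric permutation matrix, with eigenvalues `±1`. This is used to exclude
valency one, hence trivial designs. -/
theorem Q_sq_of_valency_eq_one (P : PrimitiveIdempotents S) {h : Fin (d + 1)}
    (hk : S.valency h = 1) (j : Fin (d + 1)) : P.Q h j ^ 2 = P.Q 0 j ^ 2 := by
  obtain ⟨x, y, hxy⟩ := S.rel_nonempty h
  have h1 := P.sum_rel_Q h j x y
  have h2 : ∑ z, (if S.rel x z = h then P.Q (S.rel z y) j else 0) = P.Q 0 j := by
    have h3 := S.card_rel h x
    rw [hk, Finset.card_eq_one] at h3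
    obtain ⟨w, hw⟩ := h3
    have hy : y ∈ Finset.univ.filter fun z => S.rel x z = h := by simp [hxy]
    rw [← Finset.sum_filter, hw]
    rw [hw, Finset.mem_singleton] at hy
    rw [Finset.sum_singleton, hy, S.rel_self]
  rw [h2, hk, hxy] at h1
  have hm := (P.Q_zero_left_pos j).ne'
  field_simp at h1
  push_cast at h1
  linarith

end PrimitiveIdempotents

namespace QPolynomialStructure

variable {X : Type u} [Fintype X] [DecidableEq X]

theorem thetaSecond_eq {d : ℕ} {S : AssociationScheme X d} (P : QPolynomialStructure S)
    {i : Fin (d + 1)} (hi : i ≠ 0) (h : ∀ h, h ≠ 0 → P.Q h 1 ≤ P.Q i 1) :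
    P.thetaSecond = P.Q i 1 := by
  have : Nonempty {h : Fin (d + 1) // h ≠ 0} := ⟨⟨i, hi⟩⟩
  exact le_antisymm (ciSup_le fun g => h g.1 g.2)
    (le_ciSup (f := fun g : {h : Fin (d + 1) // h ≠ 0} => P.dualEigenvalue g)
      (Set.finite_range _).bddAbove ⟨i, hi⟩)

theorem thetaLast_eq {d : ℕ} {S : AssociationScheme X d} (P : QPolynomialStructure S)
    {l : Fin (d + 1)} (h : ∀ h, P.Q l 1 ≤ P.Q h 1) : P.thetaLast = P.Q l 1 :=
  le_antisymm (ciInf_le (f := fun g => P.dualEigenvalue g) (Set.finite_range _).bddBelow l)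
    (le_ciInf fun g => h g)

variable {S : AssociationScheme X 3}

theorem isDualTight_iff (P : QPolynomialStructure S) {i l : Fin 4} (hi : i ≠ 0)
    (h1 : ∀ h, h ≠ 0 → P.Q h 1 ≤ P.Q i 1) (h2 : ∀ h, P.Q l 1 ≤ P.Q h 1) :
    P.IsDualTight ↔ ¬ P.IsQBipartite ∧ (P.krein 1 1 1 + 1) * (P.Q i 1 * P.Q l 1) +
        P.Q 0 1 * (P.Q i 1 + P.Q l 1) + P.Q 0 1 * (P.krein 1 2 1 + 1) = 0 := by
  rw [IsDualTight, P.thetaSecond_eq hi h1, P.thetaLast_eq h2]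
  exact and_congr_right fun _ => tight_equation_iff (P.krein_nonneg 1 1 1) P.one_add_krein

/-- If the third idempotent is the signature of a bipartition with `R_0, R_j` inside the parts and
`R_i, R_l` across, then `(X, R_i)` is the incidence graph of a symmetric design. -/
theorem isSymmetricDesignIncidenceGraph_of_sign (P : QPolynomialStructure S) {i j l : Fin 4}
    (hi : i ≠ 0) (hj : j ≠ 0) (hl : l ≠ 0) (hij : i ≠ j) (hil : i ≠ l) (hjl : j ≠ l)
    (h0 : P.Q 0 3 = 1) (hQi : P.Q i 3 = -1) (hQj : P.Q j 3 = 1) (hQl : P.Q l 3 = -1)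
    (hki : 1 < S.valency i) (hkl : 1 < S.valency l) :
    IsSymmetricDesignIncidenceGraph (S.graph i hi) := by
  have hcases : ∀ h : Fin 4, h = 0 ∨ h = i ∨ h = j ∨ h = l := by
    intro h
    have := Finset.mem_univ h
    rw [Fin.univ_eq_of_ne hi hj hl hij hil hjl] at this
    simpa using this
  have hsq : ∀ h, P.Q h 3 ^ 2 = 1 := by
    intro h
    rcases hcases h with rfl | rfl | rfl | rfl <;> simp [*]
  have hmul := P.Q_mul_Q_of_sq_eq_one hsq
  have hne : ∀ h, P.Q h 3 ≠ 1 ↔ P.Q h 3 = -1 := by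
    intro h
    rcases hcases h with rfl | rfl | rfl | rfl <;> norm_num [h0, hQi, hQj, hQl]
  obtain ⟨x₀, -⟩ := S.rel_nonempty 0
  -- Orthogonality of `E_3` and `E_0` says that the two parts have equal size.
  have hcard : S.valency i + S.valency l = S.valency j + 1 := by
    have h1 := P.sum_valency_mul_Q_mul_Q 3 0
    rw [Fin.sum_eq_of_ne hi hj hl hij hil hjl, if_neg (by decide)] at h1
    simp only [P.Q_zero_right, S.valency_zero, h0, hQi, hQj, hQl] at h1
    have h2 : (S.valency i : ℝ) + S.valency l = S.valency j + 1 := by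
      push_cast at h1
      linarith
    exact_mod_cast h2
  have hpts : (Fintype.card {y // P.Q (S.rel x₀ y) 3 = 1} : ℝ) = S.valency j + 1 := by
    rw [Fintype.card_subtype, Finset.card_filter]
    push_cast
    rw [S.sum_rel (fun h => if P.Q h 3 = 1 then (1 : ℝ) else 0),
      Fin.sum_eq_of_ne hi hj hl hij hil hjl]
    norm_num [h0, hQi, hQj, hQl, S.valency_zero]
    ring
  have hblk : (Fintype.card {y // ¬ P.Q (S.rel x₀ y) 3 = 1} : ℝ) = S.valency i + S.valency l := by
    rw [Fintype.card_subtype, Finset.card_filter]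
    push_cast
    rw [S.sum_rel (fun h => if ¬ P.Q h 3 = 1 then (1 : ℝ) else 0),
      Fin.sum_eq_of_ne hi hj hl hij hil hjl]
    norm_num [h0, hQi, hQj, hQl, S.valency_zero]
  obtain ⟨c, hc⟩ := S.regular i i j
  -- The points are the part of the base vertex `x₀`. Distinct points are in relation `R_j`, so `λ`
  -- is the intersection number `p_{i,i}^j`.
  let D : SymmetricDesign {y // P.Q (S.rel x₀ y) 3 = 1} {y // ¬ P.Q (S.rel x₀ y) 3 = 1} :=
    { inc := fun p b => S.rel p.1 b.1 = i
      v := S.valency j + 1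
      k := S.valency i
      l := c
      card_points := by exact_mod_cast hpts
      card_blocks := by rw [← hcard]; exact_mod_cast hblk
      block_size := by
        rintro ⟨b, hb⟩
        rw [← Set.ncard_image_of_injective _ Subtype.val_injective, ← S.card_rel i b,
          ← Set.ncard_coe_finset]
        congr 1
        ext p
        simp only [Set.mem_image, Set.mem_ofPred_eq, Subtype.exists, exists_and_right,
          exists_eq_right, Finset.coe_filter, Finset.mem_univ, true_and]
        constructor
        · rintro ⟨-, hp⟩
          rw [S.rel_symm, hp]
        · intro hp
          refine ⟨?_, by rw [S.rel_symm, hp]⟩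
          rw [← hmul x₀ b p, hp, hQi, (hne _).1 hb]
          norm_num
      balanced := by
        rintro ⟨p, hp⟩ ⟨q, hq⟩ hpq
        have hpq' : p ≠ q := fun e => hpq (Subtype.ext e)
        have hrel : S.rel p q = j := by
          have h1 := hmul p x₀ q
          rw [S.rel_symm p x₀, hp, hq] at h1
          rcases hcases (S.rel p q) with e | e | e | e
          · exact absurd ((S.rel_eq_zero_iff p q).1 e) hpq'
          · rw [e, hQi] at h1; norm_num at h1
          · exact e
          · rw [e, hQl] at h1; norm_num at h1
        rw [← hc p q hrel, ← Set.ncard_image_of_injective _ Subtype.val_injective,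
          ← Set.ncard_coe_finset]
        congr 1
        ext b
        simp only [Set.mem_image, Set.mem_ofPred_eq, Subtype.exists, exists_and_right,
          exists_eq_right, Finset.coe_filter, Finset.mem_univ, true_and, S.rel_symm b q]
        constructor
        · rintro ⟨⟨-, h1⟩, h2⟩
          exact ⟨h1, h2⟩
        · intro hb
          refine ⟨⟨?_, hb.1⟩, hb.2⟩
          rw [← ne_eq, hne, ← hmul x₀ p b, hb.1, hQi, hp]
          norm_num
      one_lt_k := hki
      k_lt := by omega }
  let side : X → Prop := fun y => P.Q (S.rel x₀ y) 3 = 1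
  refine ⟨_, _, inferInstance, inferInstance, D, ⟨⟨(Equiv.sumCompl side).symm, ?_⟩⟩⟩
  intro x y
  have hside : S.rel x y = i → P.Q (S.rel x₀ y) 3 = -P.Q (S.rel x₀ x) 3 := by
    intro h
    rw [← hmul x₀ x y, h, hQi]
    ring
  by_cases hx : P.Q (S.rel x₀ x) 3 = 1 <;> by_cases hy : P.Q (S.rel x₀ y) 3 = 1
  · rw [Equiv.sumCompl_symm_apply_of_pos (p := side) hx, Equiv.sumCompl_symm_apply_of_pos (p := side) hy]
    refine ⟨False.elim, fun h => ?_⟩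
    have := hside h
    rw [hx, hy] at this
    norm_num at this
  · rw [Equiv.sumCompl_symm_apply_of_pos (p := side) hx, Equiv.sumCompl_symm_apply_of_neg (p := side) hy]
    exact Iff.rfl
  · rw [Equiv.sumCompl_symm_apply_of_neg (p := side) hx, Equiv.sumCompl_symm_apply_of_pos (p := side) hy]
    exact ⟨fun h => (S.rel_symm x y).trans h, fun h => (S.rel_symm y x).trans h⟩
  · rw [Equiv.sumCompl_symm_apply_of_neg (p := side) hx, Equiv.sumCompl_symm_apply_of_neg (p := side) hy]
    refine ⟨False.elim, fun h => ?_⟩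
    have := hside h
    rw [(hne _).1 hx, (hne _).1 hy] at this
    norm_num at this

theorem exists_design_of_isDualTight (P : QPolynomialStructure S) (hP : P.IsDualTight) :
    ∃ (i : Fin 4) (hi : i ≠ 0), IsSymmetricDesignIncidenceGraph (S.graph i hi) := by
  obtain ⟨i, j, l, hi, hj, hl, hij, hjl⟩ := Fin.exists_strictAnti_of_injective P.Q_one_injective
  have nij : i ≠ j := fun e => hij.ne (by rw [e])
  have njl : j ≠ l := fun e => hjl.ne (by rw [e])
  have nil : i ≠ l := fun e => (hjl.trans hij).ne (by rw [e])
  have hcases : ∀ h : Fin 4, h = 0 ∨ h = i ∨ h = j ∨ h = l := by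
    intro h
    have := Finset.mem_univ h
    rw [Fin.univ_eq_of_ne hi hj hl nij nil njl] at this
    simpa using this
  rw [P.isDualTight_iff (i := i) (l := l) hi] at hP
  · obtain ⟨hbip, hG⟩ := hP
    have hm := P.Q_zero_left_pos 1
    have s1 := P.one_add_krein
    -- If `a = 0`, the tightness equation factors as `(θ_i + m)(θ_l + m) = 0`, and a dual eigenvalue
    -- `-m` makes the scheme `Q`-bipartite.
    have ha : 0 < P.krein 1 1 1 := by
      refine lt_of_le_of_ne (P.krein_nonneg 1 1 1) fun ha => hbip ?_
      rw [← ha] at hG s1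
      have h1 : (P.Q i 1 + P.Q 0 1) * (P.Q l 1 + P.Q 0 1) = 0 := by
        linear_combination hG + P.Q 0 1 * (-s1)
      rcases mul_eq_zero.1 h1 with h1 | h1
      · exact P.isQBipartite_of_eq_neg ha.symm (i := i) (by linarith)
      · exact P.isQBipartite_of_eq_neg ha.symm (i := l) (by linarith)
    obtain ⟨h0, hQi, hQj, hQl, hi0, hprod, hsum⟩ :=
      P.Q_three_of_tight hi hj hl hij hjl ha hG
    have hlt := P.Q_one_lt hi
    refine ⟨i, hi, P.isSymmetricDesignIncidenceGraph_of_sign hi hj hl nij nil njl h0 hQi hQj hQl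
      ?_ ?_⟩
    · refine lt_of_le_of_ne (S.valency_pos i) fun e => ?_
      have := P.Q_sq_of_valency_eq_one e.symm 1
      nlinarith
    -- Valency one would give `θ_l = -m`, hence `θ_i = 1`, and the formula for `θ_i + θ_l` would
    -- yield `a = 0`.
    · refine lt_of_le_of_ne (S.valency_pos l) fun e => ?_
      have h1 := P.Q_sq_of_valency_eq_one e.symm 1
      have h2 : P.Q l 1 = -P.Q 0 1 := by
        rcases sq_eq_sq_iff_eq_or_eq_neg.1 h1 with h | h
        · exact absurd h (P.Q_one_lt hl).ne
        · exact h
      rw [h2] at hprod hsum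
      have h3 : P.Q i 1 = 1 := by
        apply mul_right_cancel₀ hm.ne'
        linarith
      linarith
  · intro h hh
    rcases hcases h with rfl | rfl | rfl | rfl
    · exact absurd rfl hh
    · exact le_rfl
    · exact hij.le
    · exact (hjl.trans hij).le
  · intro h
    rcases hcases h with rfl | rfl | rfl | rfl
    · exact P.Q_le l 1
    · exact (hjl.trans hij).le
    · exact hjl.le
    · exact le_rfl

end QPolynomialStructure

/-! ### From a symmetric design to dual-tight. -/

namespace AssociationScheme

variable {X : Type u} [Fintype X]

theorem exists_path_of_rel_eq {d : ℕ} (S : AssociationScheme X d) {i j : Fin (d + 1)}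
    {x y x' y' z : X} (h : S.rel x y = S.rel x' y') (hx : S.rel x z = i) (hy : S.rel z y = j) :
    ∃ w, S.rel x' w = i ∧ S.rel w y' = j := by
  obtain ⟨p, hp⟩ := S.regular i j (S.rel x y)
  have h1 := hp x y rfl
  have h2 := hp x' y' h.symm
  have h3 : 0 < (Finset.univ.filter fun w => S.rel x' w = i ∧ S.rel w y' = j).card := by
    rw [h2, ← h1]
    exact Finset.card_pos.2 ⟨z, by simp [hx, hy]⟩
  obtain ⟨w, hw⟩ := Finset.card_pos.1 h3
  exact ⟨w, by simpa using hw⟩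

/-- A class-`3` scheme in which `R_i` is the incidence graph of a symmetric design consists of the
incidence relation, the relation of lying in the same part, and the non-incidence relation. -/
theorem exists_bipartition_of_design (S : AssociationScheme X 3) {i : Fin 4} {hi : i ≠ 0}
    (h : IsSymmetricDesignIncidenceGraph (S.graph i hi)) :
    ∃ (j l : Fin 4) (side : X → Prop), j ≠ 0 ∧ l ≠ 0 ∧ i ≠ j ∧ i ≠ l ∧ j ≠ l ∧
      (∀ x y, (side x ↔ side y) ↔ S.rel x y = 0 ∨ S.rel x y = j) ∧
      1 < S.valency i ∧ 1 < S.valency l ∧ S.valency i + S.valency l = S.valency j + 1 := by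
  classical
  obtain ⟨Pt, Bl, _, _, D, ⟨e⟩⟩ := h
  have hv : 3 < D.v := by have := D.one_lt_k; have := D.k_lt; omega
  let pt : Pt → X := fun p => e.symm (.inl p)
  let bl : Bl → X := fun b => e.symm (.inr b)
  have hadj : ∀ w w' : Pt ⊕ Bl, S.rel (e.symm w) (e.symm w') = i ↔ D.incidenceGraph.Adj w w' :=
    fun w w' => e.symm.map_rel_iff (a := w) (b := w')
  have hpb : ∀ p b, S.rel (pt p) (bl b) = i ↔ D.inc p b := fun p b => hadj (.inl p) (.inr b)
  have hbp : ∀ p b, S.rel (bl b) (pt p) = i ↔ D.inc p b := fun p b => hadj (.inr b) (.inl p)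
  have hpp : ∀ p q, S.rel (pt p) (pt q) ≠ i := fun p q h => (hadj (.inl p) (.inl q)).1 h
  have hbb : ∀ b c, S.rel (bl b) (bl c) ≠ i := fun b c h => (hadj (.inr b) (.inr c)).1 h
  have hpt : Function.Injective pt := e.symm.injective.comp Sum.inl_injective
  have hbl : Function.Injective bl := e.symm.injective.comp Sum.inr_injective
  have hptbl : ∀ p b, pt p ≠ bl b := fun p b h => Sum.inl_ne_inr (e.symm.injective h)
  have hcases : ∀ x, (∃ p, x = pt p) ∨ ∃ b, x = bl b := by
    intro x
    rcases hx : e x with p | b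
    · exact .inl ⟨p, by rw [← e.symm_apply_apply x, hx]⟩
    · exact .inr ⟨b, by rw [← e.symm_apply_apply x, hx]⟩
  have hsum : ∀ f : X → ℝ, ∑ x, f x = ∑ p, f (pt p) + ∑ b, f (bl b) := by
    intro f
    rw [← Equiv.sum_comp e.symm.toEquiv f, Fintype.sum_sum_type]
    rfl
  obtain ⟨b₀⟩ : Nonempty Bl := Fintype.card_pos_iff.1 (by rw [D.card_blocks]; omega)
  have hk : S.valency i = D.k := by
    have h1 := S.sum_rel (fun h => if h = i then (1 : ℝ) else 0) (bl b₀)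
    rw [hsum] at h1
    simp only [hbp, hbb, if_false, Finset.sum_const_zero, add_zero, mul_ite, mul_one, mul_zero,
      Finset.sum_ite_eq', Finset.mem_univ, if_true, Finset.sum_boole] at h1
    rw [← D.block_size b₀, ← Nat.cast_injective h1, ← Set.ncard_coe_finset]
    congr 1
    ext p
    simp
  have hcard : Fintype.card X = 2 * D.v := by
    rw [Fintype.card_congr e.toEquiv, Fintype.card_sum, D.card_points, D.card_blocks]
    ring
  obtain ⟨p₀, q₀, hp₀, hq₀, hpq₀⟩ : ∃ p q, D.inc p b₀ ∧ D.inc q b₀ ∧ p ≠ q := by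
    have h1 := D.one_lt_k
    rw [← D.block_size b₀, Set.one_lt_ncard] at h1
    obtain ⟨p, hp, q, hq, hpq⟩ := h1
    exact ⟨p, q, hp, hq, hpq⟩
  have hl : D.l ≠ 0 := by
    rw [← D.balanced p₀ q₀ hpq₀]
    have hne : {b | D.inc p₀ b ∧ D.inc q₀ b}.Nonempty := ⟨b₀, hp₀, hq₀⟩
    exact ((Set.ncard_pos (Set.toFinite _)).2 hne).ne'
  have hcommon : ∀ p q, p ≠ q → ∃ z, S.rel (pt p) z = i ∧ S.rel z (pt q) = i := by
    intro p q hpq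
    obtain ⟨b, hb⟩ := Set.nonempty_of_ncard_ne_zero (s := {b | D.inc p b ∧ D.inc q b})
      (by rw [D.balanced p q hpq]; exact hl)
    exact ⟨bl b, (hpb p b).2 hb.1, (hbp q b).2 hb.2⟩
  have hcross : ∀ p b, ¬ ∃ z, S.rel (pt p) z = i ∧ S.rel z (bl b) = i := by
    rintro p b ⟨z, h1, h2⟩
    rcases hcases z with ⟨q, rfl⟩ | ⟨c, rfl⟩
    · exact hpp _ _ h1
    · exact hbb _ _ h2
  -- Having a common `R_i`-neighbour depends only on the relation: two points have one since `λ ≠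
  -- 0`, a point and a block never do.
  have hdisj : ∀ p q r b, p ≠ q → S.rel (pt p) (pt q) ≠ S.rel (pt r) (bl b) := by
    intro p q r b hpq hrel
    obtain ⟨z, h1, h2⟩ := hcommon p q hpq
    exact hcross r b (S.exists_path_of_rel_eq hrel h1 h2)
  obtain ⟨r₀, hr₀⟩ : ∃ r, ¬ D.inc r b₀ := by
    by_contra! hall
    have h1 := D.block_size b₀
    rw [show {p | D.inc p b₀} = Set.univ from Set.eq_univ_of_forall hall, Set.ncard_univ,
      Nat.card_eq_fintype_card, D.card_points] at h1
    have := D.k_lt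
    omega
  obtain ⟨j, hj⟩ : ∃ j, S.rel (pt p₀) (pt q₀) = j := ⟨_, rfl⟩
  obtain ⟨l, hl⟩ : ∃ l, S.rel (pt r₀) (bl b₀) = l := ⟨_, rfl⟩
  have hj0 : j ≠ 0 := by
    rw [← hj]
    exact fun h => hpq₀ (hpt ((S.rel_eq_zero_iff _ _).1 h))
  have hl0 : l ≠ 0 := by
    rw [← hl]
    exact fun h => hptbl _ _ ((S.rel_eq_zero_iff _ _).1 h)
  have hij : i ≠ j := by rw [← hj]; exact (hpp _ _).symm
  have hil : i ≠ l := by rw [← hl]; exact fun h => hr₀ ((hpb _ _).1 h.symm)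
  have hjl : j ≠ l := by rw [← hj, ← hl]; exact hdisj _ _ _ _ hpq₀
  have hall : ∀ h : Fin 4, h = 0 ∨ h = i ∨ h = j ∨ h = l := by
    intro h
    have := Finset.mem_univ h
    rw [Fin.univ_eq_of_ne hi hj0 hl0 hij hil hjl] at this
    simpa using this
  have hsame : ∀ p q, p ≠ q → S.rel (pt p) (pt q) = j := by
    intro p q hpq
    rcases hall (S.rel (pt p) (pt q)) with h | h | h | h
    · exact absurd (hpt ((S.rel_eq_zero_iff _ _).1 h)) hpq
    · exact absurd h (hpp p q)
    · exact h
    · exact absurd (h.trans hl.symm) (hdisj _ _ _ _ hpq)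
  have hdiff : ∀ p b, S.rel (pt p) (bl b) = i ∨ S.rel (pt p) (bl b) = l := by
    intro p b
    rcases hall (S.rel (pt p) (bl b)) with h | h | h | h
    · exact absurd ((S.rel_eq_zero_iff _ _).1 h) (hptbl p b)
    · exact .inl h
    · exact absurd (hj.trans h.symm) (hdisj _ _ _ _ hpq₀)
    · exact .inr h
  have hkj : S.valency j + 1 = D.v := by
    have h1 := S.sum_rel (fun h => if h = 0 ∨ h = j then (1 : ℝ) else 0) (pt p₀)
    rw [hsum, Fin.sum_eq_of_ne hi hj0 hl0 hij hil hjl] at h1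
    have h2 : ∀ p, S.rel (pt p₀) (pt p) = 0 ∨ S.rel (pt p₀) (pt p) = j := by
      intro p
      by_cases hp : p₀ = p
      · exact .inl ((S.rel_eq_zero_iff _ _).2 (by rw [hp]))
      · exact .inr (hsame _ _ hp)
    have h3 : ∀ b, ¬ (S.rel (pt p₀) (bl b) = 0 ∨ S.rel (pt p₀) (bl b) = j) := by
      intro b
      rcases hdiff p₀ b with h | h <;> rw [h] <;> simp [hi, hij, hl0, hjl.symm]
    simp only [h2, h3, if_true, if_false, Finset.sum_const, Finset.card_univ, D.card_points,
      S.valency_zero] at h1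
    simp [hi, hij, hl0, hjl.symm] at h1
    have h4 : (D.v : ℝ) = ((S.valency j + 1 : ℕ) : ℝ) := by push_cast; linarith
    exact (Nat.cast_injective h4).symm
  have hkl : S.valency i + S.valency l = D.v := by
    have h1 := S.sum_rel (fun _ => (1 : ℝ)) (pt p₀)
    rw [Fin.sum_eq_of_ne hi hj0 hl0 hij hil hjl] at h1
    simp only [Finset.sum_const, Finset.card_univ, hcard, S.valency_zero, nsmul_eq_mul,
      mul_one] at h1
    have h2 : 2 * D.v = 1 + S.valency i + S.valency j + S.valency l := by exact_mod_cast h1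
    omega
  -- The `v` points already exhaust the `k_i + k_l = v` vertices in relation `R_i` or `R_l` to a
  -- block, so no block is among them.
  have hblocks : ∀ b c, b ≠ c → S.rel (bl b) (bl c) = j := by
    intro b c hbc
    have h1 := S.sum_rel (fun h => if h = i ∨ h = l then (1 : ℝ) else 0) (bl b)
    rw [hsum, Fin.sum_eq_of_ne hi hj0 hl0 hij hil hjl] at h1
    have h2 : ∀ p, S.rel (bl b) (pt p) = i ∨ S.rel (bl b) (pt p) = l := by
      intro p
      rw [S.rel_symm]
      exact hdiff p b
    simp only [h2, if_true, Finset.sum_const, Finset.card_univ, D.card_points] at h1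
    simp only [nsmul_eq_mul, mul_one, hi.symm, hl0.symm, or_self, if_false, mul_zero, hij.symm,
      hjl, true_or, or_true, if_true, add_zero, zero_add] at h1
    have h3 : ∑ c, (if S.rel (bl b) (bl c) = i ∨ S.rel (bl b) (bl c) = l then (1 : ℝ) else 0)
        = 0 := by
      have : (D.v : ℝ) = S.valency i + S.valency l := by rw [← hkl]; push_cast; rfl
      linarith
    rw [Finset.sum_eq_zero_iff_of_nonneg fun c _ => by split_ifs <;> norm_num] at h3
    have h4 := h3 c (Finset.mem_univ c)
    rcases hall (S.rel (bl b) (bl c)) with h | h | h | h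
    · exact absurd (hbl ((S.rel_eq_zero_iff _ _).1 h)) hbc
    · simp [h] at h4
    · exact h
    · simp [h] at h4
  refine ⟨j, l, fun x => ∃ p, x = pt p, hj0, hl0, hij, hil, hjl, ?_, ?_, ?_, ?_⟩
  · have hp : ∀ p, (∃ q, pt p = pt q) := fun p => ⟨p, rfl⟩
    have hb : ∀ b, ¬ ∃ q, bl b = pt q := fun b ⟨q, hq⟩ => hptbl q b hq.symm
    have hd : ∀ p b, ¬ (S.rel (pt p) (bl b) = 0 ∨ S.rel (pt p) (bl b) = j) := by
      intro p b
      rcases hdiff p b with h | h <;> rw [h] <;> simp [hi, hij, hl0, hjl.symm]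
    intro x y
    rcases hcases x with ⟨p, rfl⟩ | ⟨b, rfl⟩ <;> rcases hcases y with ⟨q, rfl⟩ | ⟨c, rfl⟩
    · refine iff_of_true (iff_of_true (hp p) (hp q)) ?_
      by_cases hpq : p = q
      · exact .inl (by rw [hpq, S.rel_self])
      · exact .inr (hsame p q hpq)
    · exact iff_of_false (fun h => hb c (h.1 (hp p))) (hd p c)
    · rw [S.rel_symm]
      exact iff_of_false (fun h => hb b (h.2 (hp q))) (hd q b)
    · refine iff_of_true (iff_of_false (hb b) (hb c)) ?_
      by_cases hbc : b = c
      · exact .inl (by rw [hbc, S.rel_self])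
      · exact .inr (hblocks b c hbc)
  · rw [hk]
    exact D.one_lt_k
  · have := D.k_lt
    omega
  · omega

end AssociationScheme

namespace QPolynomialStructure

variable {X : Type u} [Fintype X] [DecidableEq X] {S : AssociationScheme X 3}

/-- The dual eigenvalues of a scheme with the relations of a symmetric design. -/
theorem Q_one_of_bipartition (P : QPolynomialStructure S) {i j l : Fin 4} (hi : i ≠ 0)
    (hj : j ≠ 0) (hl : l ≠ 0) (hij : i ≠ j) (hil : i ≠ l) (hjl : j ≠ l) {side : X → Prop}
    (hside : ∀ x y, (side x ↔ side y) ↔ S.rel x y = 0 ∨ S.rel x y = j)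
    (hk : S.valency i + S.valency l = S.valency j + 1) :
    P.Q j 1 = -1 ∧ P.Q i 1 * P.Q l 1 = -P.Q 0 1 ∧ P.Q 0 1 = S.valency j ∧
      S.valency i * P.Q i 1 ^ 2 = P.Q 0 1 * S.valency l ∧
      S.valency l * P.Q l 1 ^ 2 = P.Q 0 1 * S.valency i ∧
      2 * P.krein 1 1 1 = P.Q 0 1 - 1 + (P.Q i 1 + P.Q l 1) := by
  classical
  have hm := P.Q_zero_left_pos 1
  have hki : (0 : ℝ) < S.valency i := Nat.cast_pos.2 (S.valency_pos i)
  have hkj : (0 : ℝ) < S.valency j := Nat.cast_pos.2 (S.valency_pos j)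
  have hkl : (0 : ℝ) < S.valency l := Nat.cast_pos.2 (S.valency_pos l)
  have hk' : (S.valency i : ℝ) + S.valency l = S.valency j + 1 := by exact_mod_cast hk
  have hall : ∀ h : Fin 4, h = 0 ∨ h = i ∨ h = j ∨ h = l := by
    intro h
    have := Finset.mem_univ h
    rw [Fin.univ_eq_of_ne hi hj hl hij hil hjl] at this
    simpa using this
  have e0 := P.sum_valency_mul_Q_mul_Q 0 0
  have e1 := P.sum_valency_mul_Q_mul_Q 1 0
  have e2 := P.sum_valency_mul_Q_mul_Q 1 1
  have e3 := P.krein_eq 1 1 1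
  rw [Fin.sum_eq_of_ne hi hj hl hij hil hjl] at e0 e1 e2 e3
  rw [if_pos rfl] at e0 e2
  rw [if_neg (by decide)] at e1
  simp only [P.Q_zero_right, mul_one, S.valency_zero, Nat.cast_one, one_mul] at e0 e1 e2 e3
  -- The matrix `A_0 + A_j` has equal rows within a part, so `(A_0 + A_j) E_1` does too. Rows of
  -- `E_1` at vertices in relation `R_j` differ because `θ_j ≠ m`, so the eigenvalue of `A_0 + A_j`
  -- on `E_1` is zero.
  have hθj : S.valency j * P.Q j 1 = -P.Q 0 1 := by
    have h1 : ∀ x z, ∑ y, (if side x ↔ side y then P.Q (S.rel y z) 1 else 0) =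
        (1 + S.valency j * P.Q j 1 / P.Q 0 1) * P.Q (S.rel x z) 1 := by
      intro x z
      have h2 := P.sum_rel_Q 0 1 x z
      have h3 := P.sum_rel_Q j 1 x z
      rw [S.valency_zero, Nat.cast_one, one_mul, div_self hm.ne'] at h2
      rw [add_mul, ← h2, ← h3, ← Finset.sum_add_distrib]
      refine Finset.sum_congr rfl fun y _ => ?_
      simp only [hside]
      by_cases h4 : S.rel x y = 0
      · simp [h4, hj.symm]
      · simp [h4]
    obtain ⟨x, y, hxy⟩ := S.rel_nonempty j
    have h2 : (side x ↔ side y) := (hside x y).2 (.inr hxy)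
    have h3 : (1 + S.valency j * P.Q j 1 / P.Q 0 1) * P.Q (S.rel x x) 1 =
        (1 + S.valency j * P.Q j 1 / P.Q 0 1) * P.Q (S.rel y x) 1 := by
      rw [← h1, ← h1]
      simp only [h2]
    rw [S.rel_self, S.rel_symm y x, hxy] at h3
    have h4 : 1 + S.valency j * P.Q j 1 / P.Q 0 1 = 0 := by
      by_contra hne
      exact (P.Q_one_lt hj).ne (mul_left_cancel₀ hne h3).symm
    field_simp at h4
    linarith
  have hil1 : S.valency i * P.Q i 1 + S.valency l * P.Q l 1 = 0 := by linarith
  -- Sum over pairs of `R_i`-neighbours of one vertex: distinct ones lie in the same part, hence in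
  -- relation `R_j`.
  have hsq : S.valency i ^ 2 * P.Q i 1 ^ 2 / P.Q 0 1 =
      S.valency i * P.Q 0 1 + (S.valency i ^ 2 - S.valency i) * P.Q j 1 := by
    obtain ⟨x, -⟩ := S.rel_nonempty 0
    have h1 := P.sum_sum_rel_Q i i 1 x
    have h2 : ∀ y z, (if S.rel x y = i ∧ S.rel x z = i then P.Q (S.rel y z) 1 else 0) =
        (if S.rel x y = i then (1 : ℝ) else 0) * (if S.rel x z = i then (1 : ℝ) else 0) *
          P.Q j 1 + if z = y then
            (if S.rel x y = i then (1 : ℝ) else 0) * (P.Q 0 1 - P.Q j 1) else 0 := by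
      intro y z
      by_cases hy : S.rel x y = i <;> by_cases hz : S.rel x z = i <;>
        by_cases hyz : z = y
      · simp [hy, hyz, S.rel_self]
      · have hne : S.rel y z ≠ 0 := fun h => hyz ((S.rel_eq_zero_iff y z).1 h).symm
        have hxy : ¬ (side x ↔ side y) := by rw [hside, hy]; simp [hi, hij]
        have hxz : ¬ (side x ↔ side z) := by rw [hside, hz]; simp [hi, hij]
        have hrel : S.rel y z = j := ((hside y z).1 (by tauto)).resolve_left hne
        simp [hy, hz, hyz, hrel]
      · exact absurd (hyz ▸ hy) hz
      · simp [hz, hyz]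
      · exact absurd (hyz ▸ hz) hy
      · simp [hy, hyz]
      · simp [hy, hyz]
      · simp [hy, hyz]
    have h3 : ∑ z, (if S.rel x z = i then (1 : ℝ) else 0) = S.valency i := by
      rw [S.sum_rel (fun h => if h = i then (1 : ℝ) else 0)]
      simp
    simp only [h2, Finset.sum_add_distrib, Finset.sum_ite_eq', Finset.mem_univ, if_true,
      ← Finset.sum_mul, ← Finset.mul_sum, h3] at h1
    rw [show (S.valency i : ℝ) ^ 2 * P.Q i 1 ^ 2 / P.Q 0 1 =
      S.valency i * S.valency i * (P.Q i 1 * P.Q i 1 / P.Q 0 1) by ring, ← h1]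
    ring
  have hi2 : S.valency j * (S.valency i * P.Q i 1 ^ 2) = P.Q 0 1 ^ 2 * S.valency l := by
    rw [div_eq_iff hm.ne'] at hsq
    apply mul_left_cancel₀ hki.ne'
    linear_combination S.valency j * hsq + P.Q 0 1 * (S.valency i ^ 2 - S.valency i) * hθj -
      P.Q 0 1 ^ 2 * S.valency i * hk'
  have hl2 : S.valency j * (S.valency l * P.Q l 1 ^ 2) = P.Q 0 1 ^ 2 * S.valency i := by
    apply mul_left_cancel₀ hkl.ne'
    linear_combination S.valency j * (S.valency l * P.Q l 1 - S.valency i * P.Q i 1) * hil1 +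
      S.valency i * hi2
  -- The second moment of the dual eigenvalues, with all summands now expressed through `m` and the
  -- valencies.
  have hmv : P.Q 0 1 = S.valency j := by
    have hv : (0 : ℝ) < 2 * (S.valency j + 1) * P.Q 0 1 := by positivity
    apply mul_left_cancel₀ hv.ne'
    rw [← e0] at e2
    linear_combination S.valency j * e2 - hi2 - hl2 -
      (S.valency j * P.Q j 1 - P.Q 0 1) * hθj +
      (S.valency j * P.Q 0 1 - P.Q 0 1 ^ 2) * hk'
  have hj1 : P.Q j 1 = -1 := by
    apply mul_left_cancel₀ hkj.ne'
    linarith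
  have hi3 : S.valency i * P.Q i 1 ^ 2 = P.Q 0 1 * S.valency l := by
    apply mul_left_cancel₀ hkj.ne'
    rw [hi2, ← hmv]
    ring
  have hl3 : S.valency l * P.Q l 1 ^ 2 = P.Q 0 1 * S.valency i := by
    apply mul_left_cancel₀ hkj.ne'
    rw [hl2, ← hmv]
    ring
  refine ⟨hj1, ?_, hmv, hi3, hl3, ?_⟩
  · apply mul_left_cancel₀ hkl.ne'
    linear_combination P.Q i 1 * hil1 - hi3
  -- The third moment `e3` yields `a`.
  · have hv : (0 : ℝ) < (S.valency j + 1) * P.Q 0 1 := by positivity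
    apply mul_left_cancel₀ hv.ne'
    rw [← e0, hj1, ← hmv] at e3
    rw [← hmv] at hk' ⊢
    linear_combination e3 + P.Q i 1 * hi3 + P.Q l 1 * hl3 + P.Q 0 1 * (P.Q i 1 + P.Q l 1) * hk' -
      P.Q 0 1 * hil1 - P.krein 1 1 1 * P.Q 0 1 * hk'

theorem isDualTight_of_sorted (P : QPolynomialStructure S) {i j l : Fin 4} (hi : i ≠ 0)
    (hj : j ≠ 0) (hl : l ≠ 0) (hij : i ≠ j) (hil : i ≠ l) (hjl : j ≠ l) (hj1 : P.Q j 1 = -1)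
    (hprod : P.Q i 1 * P.Q l 1 = -P.Q 0 1) (hpos : 0 < P.Q i 1) (hne : P.Q i 1 ≠ 1)
    (ha : 2 * P.krein 1 1 1 = P.Q 0 1 - 1 + (P.Q i 1 + P.Q l 1)) : P.IsDualTight := by
  have hm := P.Q_zero_left_pos 1
  have hi1 := P.Q_one_lt hi
  have s1 := P.one_add_krein
  have hlneg : P.Q l 1 < -1 := by
    by_contra hcon
    nlinarith
  have hall : ∀ h : Fin 4, h = 0 ∨ h = i ∨ h = j ∨ h = l := by
    intro h
    have := Finset.mem_univ h
    rw [Fin.univ_eq_of_ne hi hj hl hij hil hjl] at this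
    simpa using this
  rw [P.isDualTight_iff (i := i) (l := l) hi]
  · refine ⟨fun hbip => ?_, ?_⟩
    · have h1 : P.krein 1 1 1 = 0 := hbip 1
      -- With `a = 0`, multiply `ha` by `θ_i` and eliminate `θ_l` through `θ_i θ_l = -m`.
      have h2 : (P.Q i 1 - 1) * (P.Q 0 1 + P.Q i 1) = 0 := by
        rw [h1] at ha
        linear_combination -P.Q i 1 * ha - hprod
      rcases mul_eq_zero.1 h2 with h | h
      · exact hne (by linarith)
      · linarith
    · rw [hprod]
      linear_combination P.Q 0 1 * (s1 - ha)
  · intro h hh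
    rcases hall h with rfl | rfl | rfl | rfl
    · exact absurd rfl hh
    · exact le_rfl
    · linarith
    · linarith
  · intro h
    rcases hall h with rfl | rfl | rfl | rfl <;> linarith

theorem isDualTight_of_design (P : QPolynomialStructure S) {i : Fin 4} {hi : i ≠ 0}
    (h : IsSymmetricDesignIncidenceGraph (S.graph i hi)) : P.IsDualTight := by
  obtain ⟨j, l, side, hj, hl, hij, hil, hjl, hside, hki, hkl, hk⟩ :=
    S.exists_bipartition_of_design h
  obtain ⟨hj1, hprod, hmv, hi2, hl2, ha⟩ :=
    P.Q_one_of_bipartition hi hj hl hij hil hjl hside hk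
  have hm := P.Q_zero_left_pos 1
  have hki' : (2 : ℝ) ≤ S.valency i := by exact_mod_cast hki
  have hkl' : (2 : ℝ) ≤ S.valency l := by exact_mod_cast hkl
  have hk' : (S.valency i : ℝ) + S.valency l = S.valency j + 1 := by exact_mod_cast hk
  rw [← hmv] at hk'
  -- Whichever of `R_i` and `R_l` (incidence and non-incidence) has the positive dual eigenvalue
  -- takes the place of `θ₁`. That value is not `1`: otherwise the valency equations would make the
  -- other valency `1`, contrary to nontriviality.
  rcases lt_trichotomy (P.Q i 1) 0 with hi0 | hi0 | hi0
  · have hl0 : 0 < P.Q l 1 := by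
      by_contra hcon
      nlinarith
    refine P.isDualTight_of_sorted hl hj hi hjl.symm hil.symm hij.symm hj1 (by linarith) hl0
      (fun h1 => ?_) (by linarith)
    rw [h1] at hl2
    nlinarith
  · rw [hi0] at hprod
    linarith
  · refine P.isDualTight_of_sorted hi hj hl hij hil hjl hj1 hprod hi0 (fun h1 => ?_) ha
    rw [h1] at hi2
    nlinarith

end QPolynomialStructure

theorem theorem5p1 {X : Type u} [Fintype X] [DecidableEq X] (S : AssociationScheme X 3)
    (P : QPolynomialStructure S) :
    P.IsDualTight ↔
      ∃ (i : Fin 4) (hi : i ≠ 0), IsSymmetricDesignIncidenceGraph (S.graph i hi) :=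
  ⟨P.exists_design_of_isDualTight, fun ⟨_, _, h⟩ => P.isDualTight_of_design h⟩
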